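/- Let $\mathcal X,\mathcal Y,\mathcal Z$ be finite alphabets and let $p_{XYZ}$ be a PMF on $\mathcal X\times\mathcal Y\times\mathcal Z$, with $(X,Z)$-marginal $p_{XZ}$. For a PMF $p$ write $p^n$ for its $n$-fold product. For real $R$ and $C\ge 0$, the rate pair $(R,C)$ is called achievable if for every $\epsilon>0$ and all sufficiently large $n$ there are a positive integer $\Theta$ and, with $K=\lfloor 2^{nC}\rfloor$, for each $\mu\in[K]$ a randomized encoder $p^{(\mu)}_{M|X^n}$ from $\mathcal X^n$ to $[\Theta]$ and a randomized decoder $p^{(\mu)}_{Y^n|Z^nM}$ from $\mathcal Z^n\times[\Theta]$ to $\mathcal Y^n$ (conditional PMFs), such that $\frac1n\log_2\Theta\le R+\epsilon$ and $$\frac12\sum_{x^n,y^n,z^n}\bigl|p^n_{XYZ}(x^n,y^n,z^n)-p_{X^nY^nZ^n}(x^n,y^n,z^n)\bigr|\le\epsilon,$$ where $$p_{X^nY^nZ^n}(x^n,y^n,z^n)=\sum_{\mu\in[K]}\frac1K\sum_{m\in[\Theta]}p^n_{XZ}(x^n,z^n)\,p^{(\mu)}_{M|X^n}(m|x^n)\,p^{(\mu)}_{Y^n|Z^nM}(y^n|z^n,m).$$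 Theorem. For real $R$ and $C\ge0$, the pair $(R,C)$ is achievable if and only if there exist a finite alphabet $\mathcal W$ and a PMF $p_{WXYZ}$ on $\mathcal W\times\mathcal X\times\mathcal Y\times\mathcal Z$ such that (i) $p_{XYZ}(x,y,z)=\sum_{w\in\mathcal W}p_{WXYZ}(w,x,y,z)$ for all $(x,y,z)$; (ii) $Z-X-W$ and $X-(Z,W)-Y$ are Markov chains; (iii) $|\mathcal W|\le(|\mathcal X||\mathcal Y||\mathcal Z|)^2$; and $$R\ge I(X;W)-I(W;Z),\qquad R+C\ge I(XYZ;W)-I(W;Z),$$ where the mutual informations (in bits) are computed under $p_{WXYZ}$. -/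

import Mathlib

/-! Probability mass functions on a finite type `Ω` are the elements of `stdSimplex ℝ Ω`, and a random
variable on `Ω` is a function out of `Ω`. All logarithms and rates are in bits. -/

namespace ChannelSynthesis

noncomputable section

open Classical in
/-- The PMF of the random variable `f` when the outcome is distributed according to `q`. -/
def law {Ω A : Type*} [Fintype Ω] (q : Ω → ℝ) (f : Ω → A) (a : A) : ℝ :=
  ∑ ω, if f ω = a then q ω else 0

/-- The mutual information `I(f; g)`, in bits, of two random variables under `q`. Terms of
probability zero vanish, and the marginals in the other terms are positive. -/
def mutualInfo {Ω A B : Type*} [Fintype Ω] [Fintype A] [Fintype B]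
    (q : Ω → ℝ) (f : Ω → A) (g : Ω → B) : ℝ :=
  ∑ a, ∑ b, law q (fun ω => (f ω, g ω)) (a, b) *
    Real.logb 2 (law q (fun ω => (f ω, g ω)) (a, b) / (law q f a * law q g b))

/-- `f - g - h` is a Markov chain under `q`: `f` and `h` are conditionally independent given `g`,
that is, `P(a, b, c) P(b) = P(a, b) P(b, c)` for all values `a`, `b`, `c`. -/
def IsMarkovChain {Ω A B C : Type*} [Fintype Ω]
    (q : Ω → ℝ) (f : Ω → A) (g : Ω → B) (h : Ω → C) : Prop :=
  ∀ a b c, law q (fun ω => (f ω, g ω, h ω)) (a, b, c) * law q g b =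
    law q (fun ω => (f ω, g ω)) (a, b) * law q (fun ω => (g ω, h ω)) (b, c)

/-- The total variation distance `1/2 ∑ |p - q|`. -/
def tvDist {Ω : Type*} [Fintype Ω] (p q : Ω → ℝ) : ℝ :=
  (1 / 2) * ∑ ω, |p ω - q ω|

variable {X Y Z : Type*} [Fintype X] [Fintype Y] [Fintype Z]

/-- The `n`-fold product of a PMF on `X × Y × Z`, as a PMF of three sequences. -/
def iidPMF (p : X × Y × Z → ℝ) (n : ℕ) : (Fin n → X) × (Fin n → Y) × (Fin n → Z) → ℝ :=
  fun s => ∏ i, p (s.1 i, s.2.1 i, s.2.2 i)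

/-- The `n`-fold product of the `(X, Z)`-marginal of `p`, evaluated at `(x, z)`. -/
def iidSource (p : X × Y × Z → ℝ) {n : ℕ} (x : Fin n → X) (z : Fin n → Z) : ℝ :=
  ∏ i, ∑ y, p (x i, y, z i)

/-- A code of block length `n` with `K` values of the common randomness and `Θ` messages: for every
value of the common randomness, a randomized encoder `X^n → [Θ]` and a randomized decoder
`Z^n × [Θ] → Y^n`, given by the conditional PMFs that they induce. -/
structure Code (X Y Z : Type*) [Fintype X] [Fintype Y] [Fintype Z] (n K Θ : ℕ) where
  enc : Fin K → (Fin n → X) → Fin Θ → ℝ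
  enc_mem : ∀ μ x, enc μ x ∈ stdSimplex ℝ (Fin Θ)
  dec : Fin K → (Fin n → Z) → Fin Θ → (Fin n → Y) → ℝ
  dec_mem : ∀ μ z m, dec μ z m ∈ stdSimplex ℝ (Fin n → Y)

/-- The joint PMF of `(X^n, Y^n, Z^n)` that a code produces when `(X^n, Z^n)` is i.i.d. according to
the `(X, Z)`-marginal of `p` and the common randomness is uniform and independent of it. -/
def Code.inducedPMF {n K Θ : ℕ} (c : Code X Y Z n K Θ) (p : X × Y × Z → ℝ) :
    (Fin n → X) × (Fin n → Y) × (Fin n → Z) → ℝ :=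
  fun s => ∑ μ : Fin K, (K : ℝ)⁻¹ * ∑ m : Fin Θ,
    iidSource p s.1 s.2.2 * c.enc μ s.1 m * c.dec μ s.2.2 m s.2.1

/-- The set of achievable pairs `(R, C)`: for every `ε > 0` and all sufficiently large `n` there is a
code with `⌊2^(nC)⌋` values of the common randomness, of message rate at most `R + ε`, whose induced
PMF is within `ε` in total variation of the i.i.d. target. -/
def achievableRegion (p : X × Y × Z → ℝ) : Set (ℝ × ℝ) :=
  {r | ∀ ε : ℝ, 0 < ε → ∃ N : ℕ, ∀ n : ℕ, N ≤ n →
    ∃ (Θ : ℕ) (c : Code X Y Z n ⌊(2 : ℝ) ^ ((n : ℝ) * r.2)⌋₊ Θ),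
      tvDist (iidPMF p n) (c.inducedPMF p) ≤ ε ∧
      (1 / (n : ℝ)) * Real.logb 2 (Θ : ℝ) ≤ r.1 + ε}

end

end ChannelSynthesis

/-! Direct part. Factor the single-letter law into the kernels `W → X`, `X → Z` and `(Z, W) → Y`,
and draw an i.i.d. codebook of `W^n`-words indexed by `(μ, m, b)`: `μ` is the common randomness, `m`
is sent, `b` is not. Let a uniformly chosen codeword drive the memoryless channel. By
`soft_covering` the resulting triple is close to the target once the number of all codewords exceeds
`2^(n I(XYZ;W))`, and for each fixed `μ` the `X`-part is close to the source once the number of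
pairs `(m, b)` exceeds `2^(n I(X;W))`. The second fact allows the order of generation to be
reversed: the encoder draws `(m, b)` from its posterior given the source word. The decoder recovers
`b` from the side information by a likelihood threshold, which works while there are fewer than
`2^(n I(W;Z))` values of `b`; this is the saving `I(W;Z)` in both rate bounds. `one_shot` finds one
codebook for which the three errors are small together, and `achievable_of_kernels` makes them
vanish by Chebyshev's inequality for the information density.

Converse. For letter `i` of a code the auxiliary variable consists of the common randomness, the
message and the side information at the other letters. `Code.letterSlice_eq` shows that both Markov
chains then hold exactly, although the output law is only approximately right. Counting entropy and
averaging over `i` gives single-letter bounds (`Code.exists_slices`), and `entropy_le_of_tvDist`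
replaces the entropy of the code's output by that of the target.

The auxiliary alphabet still grows with `n`. To bound it, `W` is represented by its slices, the
unnormalized laws of `(X, Y, Z)` on each value of `W`. The Markov conditions are stable under
scaling and the entropy differences are homogeneous of degree one, so Carathéodory's theorem for
cones keeps the sum of the slices and the two entropy sums with few slices (`exists_slices_card`).
Families of bounded size live in a compact set, so a limit along errors tending to zero satisfies
everything exactly (`exists_limit_slices`), and `glue_spec` reassembles the limit into a joint PMF.
-/

namespace ChannelSynthesis

open Filter Topology

/-! ### Laws and Shannon entropy of finite random variables. -/

section Law

variable {Ω A B D : Type*} [Fintype Ω]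

lemma law_nonneg {q : Ω → ℝ} (hq : ∀ ω, 0 ≤ q ω) (f : Ω → A) (a : A) : 0 ≤ law q f a := by
  classical
  exact Finset.sum_nonneg fun ω _ => by split_ifs <;> simp [hq]

lemma sum_law_mul [Fintype A] (q : Ω → ℝ) (f : Ω → A) (φ : A → ℝ) :
    ∑ a, law q f a * φ a = ∑ ω, q ω * φ (f ω) := by
  classical
  simp only [law, Finset.sum_mul]
  rw [Finset.sum_comm]
  refine Finset.sum_congr rfl fun ω _ => ?_
  rw [Finset.sum_eq_single (f ω)] <;> simp +contextual [eq_comm]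

lemma sum_law [Fintype A] (q : Ω → ℝ) (f : Ω → A) : ∑ a, law q f a = ∑ ω, q ω := by
  simpa using sum_law_mul q f (fun _ => 1)

lemma law_pos {q : Ω → ℝ} (hq : ∀ ω, 0 ≤ q ω) (f : Ω → A) {ω : Ω} (h : q ω ≠ 0) :
    0 < law q f (f ω) := by
  classical
  refine Finset.sum_pos' (fun ω _ => by split_ifs <;> simp [hq]) ⟨ω, Finset.mem_univ _, ?_⟩
  simpa using lt_of_le_of_ne (hq ω) (Ne.symm h)

lemma law_comp_injective (q : Ω → ℝ) (f : Ω → A) {g : A → B} (hg : g.Injective) (a : A) :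
    law q (fun ω => g (f ω)) (g a) = law q f a := by
  classical
  simp [law, hg.eq_iff]

lemma law_id (q : Ω → ℝ) (ω : Ω) : law q (fun ω => ω) ω = q ω := by
  classical
  simp [law]

/-- The law of a function of `f` is the image of the law of `f`. -/
lemma law_comp [Fintype A] (q : Ω → ℝ) (f : Ω → A) (g : A → B) (b : B) :
    law q (fun ω => g (f ω)) b = law (law q f) g b := by
  classical
  have := sum_law_mul q f (fun a => if g a = b then 1 else 0)
  simpa [law] using this.symm

lemma sum_law_prod_right [Fintype B] (q : Ω → ℝ) (f : Ω → A) (g : Ω → B) (a : A) :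
    ∑ b, law q (fun ω => (f ω, g ω)) (a, b) = law q f a := by
  classical
  simp only [law]
  rw [Finset.sum_comm]
  refine Finset.sum_congr rfl fun ω _ => ?_
  rw [Finset.sum_eq_single (g ω)] <;> simp +contextual [eq_comm]

lemma sum_law_prod_left [Fintype A] (q : Ω → ℝ) (f : Ω → A) (g : Ω → B) (b : B) :
    ∑ a, law q (fun ω => (f ω, g ω)) (a, b) = law q g b := by
  classical
  simp only [law]
  rw [Finset.sum_comm]
  refine Finset.sum_congr rfl fun ω _ => ?_
  rw [Finset.sum_eq_single (f ω)] <;> simp +contextual [eq_comm]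

lemma law_prod_le_left {q : Ω → ℝ} (hq : ∀ ω, 0 ≤ q ω) (f : Ω → A) (g : Ω → B) (a : A) (b : B) :
    law q (fun ω => (f ω, g ω)) (a, b) ≤ law q f a := by
  classical
  refine Finset.sum_le_sum fun ω _ => ?_
  by_cases h : f ω = a <;> by_cases h' : g ω = b <;> simp [h, h', hq]

/-- Taking laws does not increase the `ℓ¹` distance. -/
lemma sum_abs_law_sub_le [Fintype A] (q r : Ω → ℝ) (f : Ω → A) :
    ∑ a, |law q f a - law r f a| ≤ ∑ ω, |q ω - r ω| := by
  classical
  calc ∑ a, |law q f a - law r f a|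
      ≤ ∑ a, law (fun ω => |q ω - r ω|) f a := by
        refine Finset.sum_le_sum fun a _ => ?_
        simp only [law, ← Finset.sum_sub_distrib]
        refine (Finset.abs_sum_le_sum_abs _ _).trans (Finset.sum_le_sum fun ω _ => ?_)
        split_ifs <;> simp
    _ = _ := sum_law _ _

/-- The Shannon entropy, in nats, of a random variable. -/
noncomputable def ent [Fintype A] (q : Ω → ℝ) (f : Ω → A) : ℝ :=
  ∑ a, Real.negMulLog (law q f a)

/-- As an expectation over outcomes, entropies of different variables can be compared termwise: an
outcome of probability zero contributes nothing, and at any other outcome every law involved is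
positive. -/
lemma ent_eq [Fintype A] (q : Ω → ℝ) (f : Ω → A) :
    ent q f = -∑ ω, q ω * Real.log (law q f (f ω)) := by
  rw [← sum_law_mul q f (fun a => Real.log (law q f a))]
  simp [ent, Real.negMulLog]

lemma ent_comp_injective [Fintype A] [Fintype B] (q : Ω → ℝ) (f : Ω → A) {g : A → B}
    (hg : g.Injective) : ent q (fun ω => g (f ω)) = ent q f := by
  simp only [ent_eq, law_comp_injective q f hg]

/-- Gibbs' inequality: cross entropy is at least entropy. -/
lemma ent_le_cross [Fintype A] {q : Ω → ℝ} (hq : ∀ ω, 0 ≤ q ω) (hq1 : ∑ ω, q ω = 1) (f : Ω → A)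
    (r : A → ℝ) (hr : ∀ a, 0 ≤ r a) (hr1 : ∑ a, r a ≤ 1) (hpos : ∀ ω, q ω ≠ 0 → 0 < r (f ω)) :
    ent q f ≤ -∑ ω, q ω * Real.log (r (f ω)) := by
  have key : ∑ ω, q ω * (Real.log (r (f ω)) - Real.log (law q f (f ω))) ≤
      ∑ a, (r a - law q f a) := by
    rw [← sum_law_mul q f (fun a => Real.log (r a) - Real.log (law q f a))]
    refine Finset.sum_le_sum fun a _ => ?_
    rcases eq_or_lt_of_le (law_nonneg hq f a) with h | h
    · simp [← h, hr a]
    · have hra : 0 < r a := by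
        by_contra hcon
        have : law q f a = 0 := by
          classical
          refine Finset.sum_eq_zero fun ω _ => ?_
          split_ifs with h1
          · by_contra h2
            exact hcon (h1 ▸ hpos ω h2)
          · rfl
        exact h.ne' this
      rw [← Real.log_div hra.ne' h.ne']
      have := Real.log_le_sub_one_of_pos (div_pos hra h)
      calc law q f a * Real.log (r a / law q f a) ≤ law q f a * (r a / law q f a - 1) := by gcongr
        _ = _ := by field_simp
  rw [ent_eq]
  simp only [mul_sub, Finset.sum_sub_distrib, sum_law, hq1] at key
  linarith

lemma ent_le_prod_left [Fintype A] [Fintype B] {q : Ω → ℝ} (hq : ∀ ω, 0 ≤ q ω)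
    (f : Ω → A) (g : Ω → B) : ent q f ≤ ent q (fun ω => (f ω, g ω)) := by
  rw [ent_eq, ent_eq, neg_le_neg_iff]
  refine Finset.sum_le_sum fun ω _ => ?_
  by_cases h : q ω = 0
  · simp [h]
  · have h1 := law_pos hq (fun ω => (f ω, g ω)) h
    exact mul_le_mul_of_nonneg_left
      (Real.log_le_log h1 (law_prod_le_left hq f g _ _)) (hq ω)

/-- Gibbs' inequality against the product of the law of `f` with the uniform PMF on `B`. -/
lemma ent_prod_le_add_log_card [Fintype A] [Fintype B] {q : Ω → ℝ} (hq : ∀ ω, 0 ≤ q ω)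
    (hq1 : ∑ ω, q ω = 1) (f : Ω → A) (g : Ω → B) :
    ent q (fun ω => (f ω, g ω)) ≤ ent q f + Real.log (Fintype.card B) := by
  have hne : Nonempty B := by
    by_contra h
    rw [not_nonempty_iff] at h
    have : IsEmpty Ω := ⟨fun ω => h.elim (g ω)⟩
    simp at hq1
  have hB : (0 : ℝ) < Fintype.card B := by exact_mod_cast Fintype.card_pos
  have := ent_le_cross hq hq1 (fun ω => (f ω, g ω)) (fun a => law q f a.1 / Fintype.card B)
    (fun a => div_nonneg (law_nonneg hq f _) hB.le)
    (by
      rw [Fintype.sum_prod_type]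
      simp [mul_div_cancel₀ _ hB.ne', sum_law, hq1])
    (fun ω h => div_pos (law_pos hq f h) hB)
  refine this.trans (le_of_eq ?_)
  rw [ent_eq]
  have : ∀ ω, q ω * Real.log (law q f (f ω) / Fintype.card B) =
      q ω * Real.log (law q f (f ω)) - q ω * Real.log (Fintype.card B) := by
    intro ω
    by_cases h : q ω = 0
    · simp [h]
    · rw [Real.log_div (law_pos hq f h).ne' hB.ne']; ring
  simp only [this, Finset.sum_sub_distrib, ← Finset.sum_mul, hq1]
  ring

/-- Subadditivity of the conditional entropy of a random vector given `s`. -/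
lemma ent_pi_le [Fintype A] [Fintype B] {n : ℕ} {q : Ω → ℝ} (hq : ∀ ω, 0 ≤ q ω)
    (hq1 : ∑ ω, q ω = 1) (f : Ω → Fin n → A) (s : Ω → B) :
    ent q (fun ω => (f ω, s ω)) - ent q s ≤
      ∑ i, (ent q (fun ω => (f ω i, s ω)) - ent q s) := by
  -- The reference law makes the coordinates of `f` conditionally independent given `s`, with the
  -- true conditional marginals. Division by zero is harmless, since the factor `law q s` kills
  -- those terms.
  have h1 := ent_le_cross hq hq1 (fun ω => (f ω, s ω))
    (fun a => law q s a.2 * ∏ i, (law q (fun ω => (f ω i, s ω)) (a.1 i, a.2) / law q s a.2))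
    (fun a => mul_nonneg (law_nonneg hq _ _) (Finset.prod_nonneg fun i _ =>
      div_nonneg (law_nonneg hq _ _) (law_nonneg hq _ _)))
    (by
      rw [Fintype.sum_prod_type_right]
      calc _ = ∑ b, law q s b * ∏ i : Fin n, ∑ a,
            (law q (fun ω => (f ω i, s ω)) (a, b) / law q s b) := by
            refine Finset.sum_congr rfl fun b _ => ?_
            dsimp only
            rw [← Finset.mul_sum, Finset.prod_univ_sum]
            simp
        _ = ∑ b, law q s b := by
            refine Finset.sum_congr rfl fun b _ => ?_
            by_cases hb : law q s b = 0
            · simp [hb]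
            · simp [← Finset.sum_div, sum_law_prod_left q (fun ω => f ω _) s b, div_self hb]
        _ ≤ 1 := by rw [sum_law, hq1])
    (fun ω h => mul_pos (law_pos hq s h) (Finset.prod_pos fun i _ =>
      div_pos (law_pos hq (fun ω => (f ω i, s ω)) h) (law_pos hq s h)))
  have h2 : ∀ ω, q ω * Real.log (law q s (s ω) *
      ∏ i, (law q (fun ω => (f ω i, s ω)) (f ω i, s ω) / law q s (s ω))) =
      q ω * Real.log (law q s (s ω)) + ∑ i, (q ω * Real.log (law q (fun ω => (f ω i, s ω)) (f ω i, s ω))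
        - q ω * Real.log (law q s (s ω))) := by
    intro ω
    by_cases h : q ω = 0
    · simp [h]
    · have hs := (law_pos hq s h).ne'
      have hf : ∀ i, law q (fun ω => (f ω i, s ω)) (f ω i, s ω) ≠ 0 :=
        fun i => (law_pos hq (fun ω => (f ω i, s ω)) h).ne'
      rw [Real.log_mul hs (Finset.prod_ne_zero_iff.2 fun i _ => div_ne_zero (hf i) hs),
        Real.log_prod (fun i _ => div_ne_zero (hf i) hs), mul_add, Finset.mul_sum]
      congr 1
      refine Finset.sum_congr rfl fun i _ => ?_
      rw [Real.log_div (hf i) hs, mul_sub]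
  simp only [h2, Finset.sum_add_distrib] at h1
  rw [Finset.sum_comm] at h1
  have e1 := ent_eq q s
  have e2 : ∀ i, ent q (fun ω => (f ω i, s ω)) - ent q s =
      -∑ ω, (q ω * Real.log (law q (fun ω => (f ω i, s ω)) (f ω i, s ω))
        - q ω * Real.log (law q s (s ω))) := by
    intro i
    rw [ent_eq, ent_eq, Finset.sum_sub_distrib]; ring
  simp only [e2, Finset.sum_neg_distrib]
  linarith

lemma mutualInfo_eq [Fintype A] [Fintype B] {q : Ω → ℝ} (hq : ∀ ω, 0 ≤ q ω)
    (f : Ω → A) (g : Ω → B) :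
    mutualInfo q f g = (ent q f + ent q g - ent q (fun ω => (f ω, g ω))) / Real.log 2 := by
  have h := sum_law_mul q (fun ω => (f ω, g ω)) (fun p =>
    Real.logb 2 (law q (fun ω => (f ω, g ω)) p / (law q f p.1 * law q g p.2)))
  rw [Fintype.sum_prod_type] at h
  rw [mutualInfo, h, ent_eq, ent_eq, ent_eq, eq_div_iff (Real.log_pos (by norm_num)).ne',
    Finset.sum_mul, ← sub_eq_zero]
  simp only [sub_neg_eq_add, ← Finset.sum_neg_distrib, ← Finset.sum_add_distrib,
    ← Finset.sum_sub_distrib]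
  refine Finset.sum_eq_zero fun ω _ => ?_
  by_cases h : q ω = 0
  · simp [h]
  · have h1 := (law_pos hq f h).ne'
    have h2 := (law_pos hq g h).ne'
    have h3 := (law_pos hq (fun ω => (f ω, g ω)) h).ne'
    rw [Real.logb, Real.log_div h3 (mul_ne_zero h1 h2), Real.log_mul h1 h2,
      mul_assoc, div_mul_cancel₀ _ (Real.log_pos (by norm_num)).ne']
    ring

/-- The logarithm of the Markov identity at each outcome of positive probability, averaged: equality
in strong subadditivity. -/
lemma ent_markov [Fintype A] [Fintype B] [Fintype D] {q : Ω → ℝ} (hq : ∀ ω, 0 ≤ q ω)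
    {f : Ω → A} {g : Ω → B} {h : Ω → D} (hM : IsMarkovChain q f g h) :
    ent q (fun ω => (f ω, g ω, h ω)) + ent q g =
      ent q (fun ω => (f ω, g ω)) + ent q (fun ω => (g ω, h ω)) := by
  simp only [ent_eq, ← neg_add, neg_inj, ← Finset.sum_add_distrib]
  refine Finset.sum_congr rfl fun ω _ => ?_
  by_cases h0 : q ω = 0
  · simp [h0]
  · rw [← mul_add, ← mul_add, ← Real.log_mul, ← Real.log_mul, hM]
    exacts [(law_pos hq (fun ω => (f ω, g ω)) h0).ne', (law_pos hq (fun ω => (g ω, h ω)) h0).ne',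
      (law_pos hq (fun ω => (f ω, g ω, h ω)) h0).ne', (law_pos hq g h0).ne']

end Law

/-! ### Random codebooks: moments, soft covering and threshold decoding. -/

section RandomCoding

variable {ι A W V : Type*} [Fintype ι] [DecidableEq ι] [Fintype A] [Fintype W]

/-- The expectation of `f c` when the entries of `c : ι → A` are i.i.d. according to `p`. -/
noncomputable def iidE (p : A → ℝ) (f : (ι → A) → ℝ) : ℝ :=
  ∑ c, (∏ i, p (c i)) * f c

lemma iidE_add (p : A → ℝ) (f g : (ι → A) → ℝ) :
    iidE p (fun c => f c + g c) = iidE p f + iidE p g := by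
  simp [iidE, mul_add, Finset.sum_add_distrib]

lemma iidE_sum {β : Type*} (s : Finset β) (p : A → ℝ) (f : β → (ι → A) → ℝ) :
    iidE p (fun c => ∑ b ∈ s, f b c) = ∑ b ∈ s, iidE p (f b) := by
  simp only [iidE, Finset.mul_sum]
  exact Finset.sum_comm

lemma iidE_mul_left (p : A → ℝ) (r : ℝ) (f : (ι → A) → ℝ) :
    iidE p (fun c => r * f c) = r * iidE p f := by
  simp only [iidE, Finset.mul_sum]
  exact Finset.sum_congr rfl fun _ _ => by ring

lemma iidE_mono {p : A → ℝ} (hp : ∀ a, 0 ≤ p a) {f g : (ι → A) → ℝ} (h : ∀ c, f c ≤ g c) :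
    iidE p f ≤ iidE p g :=
  Finset.sum_le_sum fun c _ =>
    mul_le_mul_of_nonneg_left (h c) (Finset.prod_nonneg fun _ _ => hp _)

lemma iidE_prod (p : A → ℝ) (g : ι → A → ℝ) :
    iidE p (fun c => ∏ i, g i (c i)) = ∏ i, ∑ a, p a * g i a := by
  rw [Finset.prod_univ_sum]
  simp [iidE, Finset.prod_mul_distrib]

lemma iidE_const {p : A → ℝ} (hp : ∑ a, p a = 1) (r : ℝ) :
    iidE p (fun _ : ι → A => r) = r := by
  have := iidE_prod p (fun (_ : ι) _ => 1)
  simp only [mul_one, hp, Finset.prod_const_one] at this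
  simpa [this] using iidE_mul_left p r (fun _ : ι → A => 1)

lemma iidE_single {p : A → ℝ} (hp : ∑ a, p a = 1) (i : ι) (g : A → ℝ) :
    iidE p (fun c => g (c i)) = ∑ a, p a * g a := by
  have := iidE_prod p (fun j a => if j = i then g a else 1)
  rw [Finset.prod_eq_single i (by intro j _ h; simp [h, hp]) (by simp)] at this
  simpa [Finset.prod_ite_eq'] using this

lemma iidE_pair {p : A → ℝ} (hp : ∑ a, p a = 1) {i j : ι} (hij : i ≠ j) (g h : A → ℝ) :
    iidE p (fun c => g (c i) * h (c j)) = (∑ a, p a * g a) * ∑ a, p a * h a := by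
  have := iidE_prod p (fun k a => (if k = i then g a else 1) * (if k = j then h a else 1))
  rw [Finset.prod_eq_mul i j hij (by rintro k _ ⟨h1, h2⟩; simp [h1, h2, hp]) (by simp) (by simp)]
    at this
  simpa only [Finset.prod_mul_distrib, Finset.prod_ite_eq', Finset.mem_univ, if_true, hij, hij.symm,
    if_false, mul_one, one_mul] using this

lemma exists_le_iidE {p : A → ℝ} (hp0 : ∀ a, 0 ≤ p a) (hp : ∑ a, p a = 1) (f : (ι → A) → ℝ) :
    ∃ c, f c ≤ iidE p f := by
  by_contra! hcon
  have h1 : ∑ c : ι → A, ∏ i, p (c i) = 1 := by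
    simpa [iidE] using iidE_const (ι := ι) hp 1
  obtain ⟨c, -, hc⟩ : ∃ c ∈ (Finset.univ : Finset (ι → A)), 0 < ∏ i, p (c i) := by
    by_contra! h
    have := Finset.sum_nonpos h
    linarith
  have h2 : ∑ c : ι → A, (∏ i, p (c i)) * iidE p f < ∑ c, (∏ i, p (c i)) * f c :=
    Finset.sum_lt_sum (fun c _ => mul_le_mul_of_nonneg_left (hcon c).le
      (Finset.prod_nonneg fun _ _ => hp0 _)) ⟨c, Finset.mem_univ _, mul_lt_mul_of_pos_left (hcon c) hc⟩
  rw [← Finset.sum_mul, h1, one_mul] at h2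
  exact lt_irrefl _ h2

/-- The variance of `|f|` is nonnegative. -/
lemma iidE_abs_le_sqrt {p : A → ℝ} (hp0 : ∀ a, 0 ≤ p a) (hp : ∑ a, p a = 1) (f : (ι → A) → ℝ) :
    iidE p (fun c => |f c|) ≤ √(iidE p (fun c => f c ^ 2)) := by
  apply Real.le_sqrt_of_sq_le
  set m := iidE p (fun c => |f c|)
  have h : 0 ≤ iidE p (fun c => (|f c| - m) ^ 2) :=
    Finset.sum_nonneg fun c _ => mul_nonneg (Finset.prod_nonneg fun _ _ => hp0 _) (sq_nonneg _)
  have e : iidE p (fun c => (|f c| - m) ^ 2) =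
      iidE p (fun c => f c ^ 2) + (-2 * m * m + m ^ 2) := by
    rw [show (fun c : ι → A => (|f c| - m) ^ 2) =
      fun c => f c ^ 2 + (-2 * m * |f c| + m ^ 2) by
        funext c; rw [← sq_abs (f c)]; ring, iidE_add, iidE_add, iidE_mul_left, iidE_const hp]
  rw [e] at h
  linarith

/-- Cross terms vanish by independence and zero mean. The sum runs over a subset `s` because
covering is also needed for the part of the codebook belonging to one value of the common
randomness. -/
lemma iidE_sum_sq {p : A → ℝ} (hp : ∑ a, p a = 1) (s : Finset ι) {g : A → ℝ}
    (hg : ∑ a, p a * g a = 0) :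
    iidE p (fun c => (∑ i ∈ s, g (c i)) ^ 2) = s.card * ∑ a, p a * g a ^ 2 := by
  simp only [sq, Finset.sum_mul_sum]
  rw [iidE_sum]
  simp only [iidE_sum]
  rw [← nsmul_eq_mul, ← Finset.sum_const]
  refine Finset.sum_congr rfl fun i hi => ?_
  rw [Finset.sum_eq_single i]
  · exact iidE_single hp i (fun a => g a * g a)
  · intro j _ hj
    rw [iidE_pair hp hj.symm, hg, zero_mul]
  · exact fun h => absurd hi h

/-- Chebyshev's inequality for the sum of `n` independent copies of `g`. -/
lemma chebyshev {p : A → ℝ} (hp0 : ∀ a, 0 ≤ p a) (hp : ∑ a, p a = 1) {g : A → ℝ} {m δ : ℝ}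
    (hm : ∑ a, p a * g a = m) (hδ : 0 < δ) {n : ℕ} (hn : 0 < n) :
    iidE p (fun c : Fin n → A => if n * δ < |∑ i, g (c i) - n * m| then 1 else 0) ≤
      (∑ a, p a * (g a - m) ^ 2) / (n * δ ^ 2) := by
  have hn' : (0 : ℝ) < n := by exact_mod_cast hn
  have hg : ∑ a, p a * (g a - m) = 0 := by
    simp [mul_sub, Finset.sum_sub_distrib, hm, ← Finset.sum_mul, hp]
  have h := iidE_sum_sq (ι := Fin n) hp Finset.univ hg
  have e : (∑ a, p a * (g a - m) ^ 2) / (n * δ ^ 2) =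
      iidE p (fun c : Fin n → A => ((n * δ) ^ 2)⁻¹ * (∑ i, (g (c i) - m)) ^ 2) := by
    rw [iidE_mul_left, h]
    simp only [Finset.card_univ, Fintype.card_fin]
    field_simp
  rw [e]
  refine iidE_mono hp0 fun c => ?_
  have hs : ∑ i, (g (c i) - m) = ∑ i, g (c i) - n * m := by simp [Finset.sum_sub_distrib]
  rw [hs]
  split_ifs with hc
  · rw [inv_mul_eq_div, one_le_div (by positivity), ← sq_abs (∑ i, g (c i) - n * m)]
    gcongr
  · positivity

/-- The output PMF of the channel `κ` with input PMF `p`. -/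
noncomputable def outPMF (p : W → ℝ) (κ : W → V → ℝ) (v : V) : ℝ := ∑ w, p w * κ w v

lemma outPMF_nonneg {p : W → ℝ} (hp0 : ∀ w, 0 ≤ p w) {κ : W → V → ℝ} (hκ : ∀ w v, 0 ≤ κ w v)
    (v : V) : 0 ≤ outPMF p κ v :=
  Finset.sum_nonneg fun w _ => mul_nonneg (hp0 w) (hκ w v)

open Classical in
/-- The threshold decoder: some index whose codeword has likelihood ratio above `t`, if any. -/
noncomputable def thresholdDec {β : Type*} [Inhabited β] (p : W → ℝ) (κ : W → V → ℝ) (t : ℝ)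
    (c : β → W) (v : V) : β :=
  if h : ∃ b, t * outPMF p κ v < κ (c b) v then h.choose else default

open Classical in
-- If the true codeword passes the test, the decoder picks some index that passes; an error then
-- exhibits a wrong index that passes, and the union bound applies.
lemma thresholdDec_error_le {β : Type*} [Fintype β] [Inhabited β] (p : W → ℝ) (κ : W → V → ℝ)
    (t : ℝ) (c : β → W) (v : V) (b : β) :
    (if thresholdDec p κ t c v ≠ b then (1 : ℝ) else 0) ≤
      (if κ (c b) v ≤ t * outPMF p κ v then 1 else 0) +
        ∑ b' ∈ Finset.univ.erase b, if t * outPMF p κ v < κ (c b') v then 1 else 0 := by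
  have h0 : 0 ≤ ∑ b' ∈ Finset.univ.erase b,
      if t * outPMF p κ v < κ (c b') v then (1 : ℝ) else 0 :=
    Finset.sum_nonneg fun _ _ => by split_ifs <;> norm_num
  by_cases hb : κ (c b) v ≤ t * outPMF p κ v
  · simp only [hb, if_true]
    split_ifs <;> linarith
  by_cases hd : thresholdDec p κ t c v ≠ b
  · have hex : ∃ b, t * outPMF p κ v < κ (c b) v := ⟨b, not_le.1 hb⟩
    have hch : t * outPMF p κ v < κ (c (thresholdDec p κ t c v)) v := by
      simpa only [thresholdDec, dif_pos hex] using hex.choose_spec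
    have := Finset.single_le_sum (f := fun b' =>
      if t * outPMF p κ v < κ (c b') v then (1 : ℝ) else 0)
      (fun _ _ => by split_ifs <;> norm_num)
      (Finset.mem_erase.2 ⟨hd, Finset.mem_univ (thresholdDec p κ t c v)⟩)
    simp only [hch, if_true] at this
    rw [if_pos hd, if_neg hb]
    linarith
  · rw [if_neg hd, if_neg hb]
    linarith

variable [Fintype V]

lemma sum_outPMF {p : W → ℝ} (hp : ∑ w, p w = 1) {κ : W → V → ℝ} (hκ1 : ∀ w, ∑ v, κ w v = 1) :
    ∑ v, outPMF p κ v = 1 := by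
  simp only [outPMF]
  rw [Finset.sum_comm]
  simp [← Finset.mul_sum, hκ1, hp]

open Classical in
/-- The probability that the likelihood ratio `κ w v / outPMF v` exceeds `t`. -/
noncomputable def tailAbove (p : W → ℝ) (κ : W → V → ℝ) (t : ℝ) : ℝ :=
  ∑ w, p w * ∑ v, if t * outPMF p κ v < κ w v then κ w v else 0

open Classical in
/-- The probability that the likelihood ratio `κ w v / outPMF v` does not exceed `t`. -/
noncomputable def tailBelow (p : W → ℝ) (κ : W → V → ℝ) (t : ℝ) : ℝ :=
  ∑ w, p w * ∑ v, if κ w v ≤ t * outPMF p κ v then κ w v else 0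

/-- Soft covering: the average of `κ` over a random codebook approximates the output PMF. -/
lemma soft_covering {p : W → ℝ} (hp0 : ∀ w, 0 ≤ p w) (hp : ∑ w, p w = 1) {κ : W → V → ℝ}
    (hκ : ∀ w v, 0 ≤ κ w v) (hκ1 : ∀ w, ∑ v, κ w v = 1) (s : Finset ι) (hs : s.Nonempty)
    {t : ℝ} (ht : 0 ≤ t) :
    iidE p (fun c => ∑ v, |(s.card : ℝ)⁻¹ * ∑ i ∈ s, κ (c i) v - outPMF p κ v|) ≤
      2 * tailAbove p κ t + √(t / s.card) := by
  classical
  obtain ⟨L, hL⟩ : ∃ L : ℝ, L = s.card := ⟨_, rfl⟩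
  have hc : 0 < L := by rw [hL]; exact_mod_cast hs.card_pos
  rw [← hL]
  -- Truncation: `f` is the part of `κ` with likelihood ratio at most `t`, whose variance is under
  -- control; `g` is the rest, bounded only through its mass, once in the codebook average and once
  -- in the output PMF.
  obtain ⟨f, hf⟩ : ∃ f : W → V → ℝ, f = fun w v => if t * outPMF p κ v < κ w v then 0 else κ w v :=
    ⟨_, rfl⟩
  obtain ⟨g, hg⟩ : ∃ g : W → V → ℝ, g = fun w v => if t * outPMF p κ v < κ w v then κ w v else 0 :=
    ⟨_, rfl⟩
  obtain ⟨m, hm⟩ : ∃ m : V → ℝ, m = fun v => ∑ w, p w * f w v := ⟨_, rfl⟩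
  obtain ⟨r, hr⟩ : ∃ r : V → ℝ, r = fun v => ∑ w, p w * g w v := ⟨_, rfl⟩
  have hfg : ∀ w v, κ w v = f w v + g w v := by
    intro w v; simp only [hf, hg]; split_ifs <;> simp
  have hg0 : ∀ w v, 0 ≤ g w v := by
    intro w v; simp only [hg]; split_ifs <;> simp [hκ]
  have hmr : ∀ v, outPMF p κ v = m v + r v := by
    intro v; simp only [outPMF, hfg, mul_add, Finset.sum_add_distrib, hm, hr]
  have hr0 : ∀ v, 0 ≤ r v := fun v => by
    rw [hr]; exact Finset.sum_nonneg fun w _ => mul_nonneg (hp0 w) (hg0 w v)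
  have hrt : ∑ v, r v = tailAbove p κ t := by
    simp only [hr, hg, tailAbove, Finset.mul_sum]
    exact Finset.sum_comm
  have ho : ∀ v, 0 ≤ outPMF p κ v := outPMF_nonneg hp0 hκ
  have hvar : ∀ v, iidE p (fun c : ι → W => |L⁻¹ * ∑ i ∈ s, f (c i) v - m v|) ≤
      outPMF p κ v * √(t / L) := by
    intro v
    refine (iidE_abs_le_sqrt hp0 hp _).trans ?_
    apply Real.sqrt_le_iff.2 ⟨mul_nonneg (ho v) (Real.sqrt_nonneg _), ?_⟩
    rw [mul_pow, Real.sq_sqrt (by positivity)]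
    have hz : ∑ w, p w * (f w v - m v) = 0 := by
      simp [mul_sub, Finset.sum_sub_distrib, ← Finset.sum_mul, hp, hm]
    have e : (fun c : ι → W => (L⁻¹ * ∑ i ∈ s, f (c i) v - m v) ^ 2) =
        fun c => (L⁻¹) ^ 2 * (∑ i ∈ s, (f (c i) v - m v)) ^ 2 := by
      funext c
      rw [Finset.sum_sub_distrib, Finset.sum_const, nsmul_eq_mul, ← hL, ← mul_pow, mul_sub]
      field_simp
    rw [e, iidE_mul_left, iidE_sum_sq hp s (g := fun w => f w v - m v) hz, ← hL]
    have h1 : ∑ w, p w * (f w v - m v) ^ 2 ≤ ∑ w, p w * f w v ^ 2 := by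
      have : ∑ w, p w * (f w v - m v) ^ 2 = ∑ w, p w * f w v ^ 2 - m v ^ 2 := by
        have : ∀ w, p w * (f w v - m v) ^ 2 =
          p w * f w v ^ 2 - 2 * m v * (p w * f w v) + m v ^ 2 * p w := fun w => by ring
        simp only [this, Finset.sum_add_distrib, Finset.sum_sub_distrib, ← Finset.mul_sum, hp]
        rw [show ∑ w, p w * f w v = m v by rw [hm]]
        ring
      nlinarith [sq_nonneg (m v)]
    -- The truncation turns one of the two factors `f` into `t * outPMF`, so that the standard
    -- deviation is proportional to `outPMF p κ v` and sums over `v`.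
    have h2 : ∑ w, p w * f w v ^ 2 ≤ outPMF p κ v * (t * outPMF p κ v) := by
      rw [show outPMF p κ v * (t * outPMF p κ v) = ∑ w, p w * κ w v * (t * outPMF p κ v) by
        rw [← Finset.sum_mul]; rfl]
      refine Finset.sum_le_sum fun w _ => ?_
      rw [mul_assoc]
      refine mul_le_mul_of_nonneg_left ?_ (hp0 w)
      simp only [hf]
      split_ifs with h
      · simpa using mul_nonneg (hκ w v) (mul_nonneg ht (ho v))
      · rw [sq]
        exact mul_le_mul_of_nonneg_left (not_lt.1 h) (hκ w v)
    calc (L⁻¹) ^ 2 * (L * ∑ w, p w * (f w v - m v) ^ 2)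
        ≤ (L⁻¹) ^ 2 * (L * (outPMF p κ v * (t * outPMF p κ v))) := by
          gcongr; exact h1.trans h2
      _ = outPMF p κ v ^ 2 * (t / L) := by field_simp
  calc iidE p (fun c => ∑ v, |L⁻¹ * ∑ i ∈ s, κ (c i) v - outPMF p κ v|)
      ≤ iidE p (fun c => ∑ v, (|L⁻¹ * ∑ i ∈ s, f (c i) v - m v| +
          (L⁻¹ * ∑ i ∈ s, g (c i) v + r v))) := by
        refine iidE_mono hp0 fun c => Finset.sum_le_sum fun v _ => ?_
        have e : L⁻¹ * ∑ i ∈ s, κ (c i) v - outPMF p κ v =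
          (L⁻¹ * ∑ i ∈ s, f (c i) v - m v) +
          (L⁻¹ * ∑ i ∈ s, g (c i) v - r v) := by
          rw [hmr]; simp only [hfg, Finset.sum_add_distrib]; ring
        rw [e]
        refine (abs_add_le _ _).trans (add_le_add le_rfl ((abs_sub _ _).trans ?_))
        rw [abs_of_nonneg (hr0 v), abs_of_nonneg
          (mul_nonneg (by positivity) (Finset.sum_nonneg fun i _ => hg0 _ _))]
    _ ≤ ∑ v, (outPMF p κ v * √(t / L) + (r v + r v)) := by
        rw [iidE_sum]
        refine Finset.sum_le_sum fun v _ => ?_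
        rw [iidE_add, iidE_add, iidE_const hp, iidE_mul_left, iidE_sum]
        have : ∀ i ∈ s, iidE p (fun c : ι → W => g (c i) v) = r v :=
          fun i _ => by rw [hr]; exact iidE_single hp i (fun w => g w v)
        rw [Finset.sum_congr rfl this, Finset.sum_const, nsmul_eq_mul, ← hL, inv_mul_cancel_left₀ hc.ne']
        exact add_le_add (hvar v) le_rfl
    _ = 2 * tailAbove p κ t + √(t / L) := by
        rw [Finset.sum_add_distrib, ← Finset.sum_mul, sum_outPMF hp hκ1, Finset.sum_add_distrib,
          hrt]
        ring

open Classical in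
/-- The average error probability of threshold decoding with a random codebook; the codewords are
the entries of `c` at the indices `e b`. -/
lemma iidE_thresholdDec_error_le {β : Type*} [Fintype β] [Inhabited β] {p : W → ℝ}
    (hp0 : ∀ w, 0 ≤ p w) (hp : ∑ w, p w = 1) {κ : W → V → ℝ} (hκ : ∀ w v, 0 ≤ κ w v)
    (hκ1 : ∀ w, ∑ v, κ w v = 1) {t : ℝ} (ht : 0 < t) {e : β → ι} (he : e.Injective) (b : β) :
    iidE p (fun c => ∑ v, κ (c (e b)) v *
      (if thresholdDec p κ t (fun b => c (e b)) v ≠ b then 1 else 0)) ≤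
      tailBelow p κ t + ((Fintype.card β : ℝ) - 1) / t := by
  have ho : ∀ v, 0 ≤ outPMF p κ v := outPMF_nonneg hp0 hκ
  calc _ ≤ iidE p (fun c => ∑ v, (κ (c (e b)) v *
        (if κ (c (e b)) v ≤ t * outPMF p κ v then 1 else 0) +
        ∑ b' ∈ Finset.univ.erase b, κ (c (e b)) v *
          (if t * outPMF p κ v < κ (c (e b')) v then 1 else 0))) := by
        refine iidE_mono hp0 fun c => Finset.sum_le_sum fun v _ => ?_
        rw [← Finset.mul_sum, ← mul_add]
        exact mul_le_mul_of_nonneg_left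
          (thresholdDec_error_le p κ t (fun b => c (e b)) v b) (hκ _ _)
    _ = tailBelow p κ t + ∑ v, ∑ b' ∈ Finset.univ.erase b, outPMF p κ v *
          ∑ w, p w * (if t * outPMF p κ v < κ w v then 1 else 0) := by
        rw [iidE_sum, show tailBelow p κ t = ∑ v, ∑ w, p w * (κ w v *
          if κ w v ≤ t * outPMF p κ v then 1 else 0) by
            rw [Finset.sum_comm]; simp [tailBelow, Finset.mul_sum], ← Finset.sum_add_distrib]
        refine Finset.sum_congr rfl fun v _ => ?_
        rw [iidE_add, iidE_sum]
        congr 1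
        · exact iidE_single hp (e b) (fun w => κ w v * if κ w v ≤ t * outPMF p κ v then 1 else 0)
        · refine Finset.sum_congr rfl fun b' hb' => ?_
          exact iidE_pair hp (fun h => (Finset.ne_of_mem_erase hb') (he h).symm)
            (fun w => κ w v) (fun w => if t * outPMF p κ v < κ w v then 1 else 0)
    _ ≤ tailBelow p κ t + ∑ v, ∑ b' ∈ Finset.univ.erase b, outPMF p κ v / t := by
        -- A wrong codeword is independent of the channel output. Where it passes the test, `outPMF
        -- p κ v` is less than `κ w v / t`, so it passes with probability at most `1 / t` in total.
        gcongr with v _ b' _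
        rw [Finset.mul_sum]
        conv_rhs => rw [outPMF, Finset.sum_div]
        refine Finset.sum_le_sum fun w _ => ?_
        split_ifs with h
        · rw [le_div_iff₀ ht]
          nlinarith [mul_le_mul_of_nonneg_left h.le (hp0 w)]
        · simpa using div_nonneg (mul_nonneg (hp0 w) (hκ w v)) ht.le
    _ = _ := by
        simp only [Finset.sum_const, nsmul_eq_mul, ← Finset.mul_sum, ← Finset.sum_div,
          sum_outPMF hp hκ1, Finset.card_erase_of_mem (Finset.mem_univ b), Finset.card_univ]
        rw [Nat.cast_sub (Fintype.card_pos_iff.2 ⟨b⟩)]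
        push_cast
        ring

end RandomCoding

/-- Nonnegative weights are a multiple of a PMF, even when they all vanish. -/
lemma exists_normalized {β : Type*} [Fintype β] [Nonempty β] {a : β → ℝ} (ha : ∀ b, 0 ≤ a b) :
    ∃ l ∈ stdSimplex ℝ β, ∀ b, a b = (∑ b, a b) * l b := by
  classical
  by_cases h : ∑ b, a b = 0
  · refine ⟨Pi.single (Classical.arbitrary β) 1, single_mem_stdSimplex _ _, fun b => ?_⟩
    rw [h, zero_mul]
    exact (Finset.sum_eq_zero_iff_of_nonneg fun b _ => ha b).1 h b (Finset.mem_univ b)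
  · refine ⟨fun b => a b / ∑ b, a b, ⟨fun b => div_nonneg (ha b)
      (Finset.sum_nonneg fun b _ => ha b), ?_⟩, fun b => (mul_div_cancel₀ _ h).symm⟩
    rw [← Finset.sum_div, div_self h]

/-! ### One-shot code: likelihood encoder and threshold decoder. -/

section OneShot

variable {W X Y Z S M β : Type*} [Fintype X] [Fintype Y] [Fintype Z]
  [Fintype S] [Fintype M] [Fintype β]

/-- The cascade `W → X → Z` of two channels. -/
noncomputable def cascade (κ₁ : W → X → ℝ) (κ₂ : X → Z → ℝ) (w : W) (z : Z) : ℝ :=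
  ∑ x, κ₁ w x * κ₂ x z

/-- The channel `W → X × Y × Z` obtained from `W → X`, `X → Z` and `Z × W → Y`. -/
def tripleChannel (κ₁ : W → X → ℝ) (κ₂ : X → Z → ℝ) (κ₃ : Z → W → Y → ℝ) (w : W)
    (s : X × Y × Z) : ℝ :=
  κ₁ w s.1 * κ₂ s.1 s.2.2 * κ₃ s.2.2 w s.2.1

lemma sum_cascade {κ₁ : W → X → ℝ} {κ₂ : X → Z → ℝ} (h₁ : ∀ w, κ₁ w ∈ stdSimplex ℝ X)
    (h₂ : ∀ x, κ₂ x ∈ stdSimplex ℝ Z) (w : W) : ∑ z, cascade κ₁ κ₂ w z = 1 := by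
  simp only [cascade]
  rw [Finset.sum_comm]
  simp [← Finset.mul_sum, (h₂ _).2, (h₁ _).2]

lemma sum_tripleChannel {κ₁ : W → X → ℝ} {κ₂ : X → Z → ℝ} {κ₃ : Z → W → Y → ℝ}
    (h₁ : ∀ w, κ₁ w ∈ stdSimplex ℝ X) (h₂ : ∀ x, κ₂ x ∈ stdSimplex ℝ Z)
    (h₃ : ∀ z w, κ₃ z w ∈ stdSimplex ℝ Y) (w : W) : ∑ s, tripleChannel κ₁ κ₂ κ₃ w s = 1 := by
  simp only [tripleChannel, Fintype.sum_prod_type]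
  calc _ = ∑ x, κ₁ w x * ∑ z, κ₂ x z * ∑ y, κ₃ z w y := by
        refine Finset.sum_congr rfl fun x _ => ?_
        rw [Finset.sum_comm, Finset.mul_sum]
        refine Finset.sum_congr rfl fun z _ => ?_
        rw [← Finset.mul_sum, mul_assoc]
    _ = 1 := by simp [(h₃ _ _).2, (h₂ _).2, (h₁ _).2]

/-- Replacing the source by the output of the random codebook, when the message is drawn from the
posterior of the codeword index. -/
lemma likelihood_encoder_error {pX : X → ℝ} {a : S → M × β → X → ℝ} {κ₂ : X → Z → ℝ}
    (h₂ : ∀ x, κ₂ x ∈ stdSimplex ℝ Z) {d : S → Z → M → Y → ℝ}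
    (hd : ∀ μ z m, d μ z m ∈ stdSimplex ℝ Y) {l : S → X → M × β → ℝ}
    (hl : ∀ μ x, l μ x ∈ stdSimplex ℝ (M × β))
    (hal : ∀ μ x b, a μ b x = (∑ b, a μ b x) * l μ x b) {k r : ℝ} (hk : 0 ≤ k) :
    ∑ s : X × Y × Z, |(∑ μ, k * ∑ m, ∑ b, r * a μ (m, b) s.1 * κ₂ s.1 s.2.2 * d μ s.2.2 m s.2.1) -
        ∑ μ, k * ∑ m, pX s.1 * κ₂ s.1 s.2.2 * (∑ b, l μ s.1 (m, b)) * d μ s.2.2 m s.2.1| ≤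
      ∑ μ, k * ∑ x, |r * ∑ b, a μ b x - pX x| := by
  have hpt : ∀ s : X × Y × Z,
      |(∑ μ, k * ∑ m, ∑ b, r * a μ (m, b) s.1 * κ₂ s.1 s.2.2 * d μ s.2.2 m s.2.1) -
        ∑ μ, k * ∑ m, pX s.1 * κ₂ s.1 s.2.2 * (∑ b, l μ s.1 (m, b)) * d μ s.2.2 m s.2.1| ≤
      ∑ μ, k * ∑ m, |r * ∑ b, a μ b s.1 - pX s.1| * (∑ b, l μ s.1 (m, b)) * κ₂ s.1 s.2.2 *
        d μ s.2.2 m s.2.1 := by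
    rintro ⟨x, y, z⟩
    dsimp only
    rw [← Finset.sum_sub_distrib]
    refine (Finset.abs_sum_le_sum_abs _ _).trans (Finset.sum_le_sum fun μ _ => ?_)
    rw [← mul_sub, abs_mul, abs_of_nonneg hk, ← Finset.sum_sub_distrib]
    refine mul_le_mul_of_nonneg_left ((Finset.abs_sum_le_sum_abs _ _).trans
      (Finset.sum_le_sum fun m _ => le_of_eq ?_)) hk
    -- Bayes' rule: codeword likelihood equals total likelihood times posterior. Both PMFs then
    -- differ only in the weight of `x`, and everything downstream sums to one.
    have e : ∑ b, r * a μ (m, b) x * κ₂ x z * d μ z m y =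
        (r * ∑ b, a μ b x) * (∑ b, l μ x (m, b)) * κ₂ x z * d μ z m y := by
      simp only [Finset.mul_sum, Finset.sum_mul (s := (Finset.univ : Finset β))]
      refine Finset.sum_congr rfl fun b _ => ?_
      rw [hal μ x (m, b), ← Finset.mul_sum]
      ring
    rw [e, show (r * ∑ b, a μ b x) * (∑ b, l μ x (m, b)) * κ₂ x z * d μ z m y -
      pX x * κ₂ x z * (∑ b, l μ x (m, b)) * d μ z m y =
      (r * ∑ b, a μ b x - pX x) * (∑ b, l μ x (m, b)) * κ₂ x z * d μ z m y by ring,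
      abs_mul, abs_mul, abs_mul, abs_of_nonneg ((hd μ z m).1 y), abs_of_nonneg ((h₂ x).1 z),
      abs_of_nonneg (Finset.sum_nonneg fun b _ => (hl μ x).1 (m, b))]
  refine (Finset.sum_le_sum fun s _ => hpt s).trans (le_of_eq ?_)
  rw [Finset.sum_comm]
  refine Finset.sum_congr rfl fun μ _ => ?_
  rw [← Finset.mul_sum, Fintype.sum_prod_type]
  congr 1
  refine Finset.sum_congr rfl fun x _ => ?_
  rw [Fintype.sum_prod_type_right]
  calc _ = ∑ z, |r * ∑ b, a μ b x - pX x| * κ₂ x z * ∑ m, (∑ b, l μ x (m, b)) * ∑ y, d μ z m y := by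
        refine Finset.sum_congr rfl fun z _ => ?_
        rw [Finset.sum_comm, Finset.mul_sum]
        refine Finset.sum_congr rfl fun m _ => ?_
        dsimp only
        rw [← Finset.mul_sum]
        ring
    _ = _ := by
        have : ∑ m, ∑ b, l μ x (m, b) = 1 := by
          rw [← Fintype.sum_prod_type]; exact (hl μ x).2
        simp [(hd _ _ _).2, this, ← Finset.mul_sum, (h₂ _).2]

open Classical in
/-- Replacing the decoded index by the true one. -/
lemma decoded_index_error {κ₁ : W → X → ℝ} {κ₂ : X → Z → ℝ} {κ₃ : Z → W → Y → ℝ}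
    (h₁ : ∀ w, κ₁ w ∈ stdSimplex ℝ X) (h₂ : ∀ x, κ₂ x ∈ stdSimplex ℝ Z)
    (h₃ : ∀ z w, κ₃ z w ∈ stdSimplex ℝ Y) (c : S × M × β → W) (g : S → Z → M → β) {k r : ℝ}
    (hk : 0 ≤ k) (hr : 0 ≤ r) :
    ∑ s : X × Y × Z, |(∑ μ, k * ∑ m, ∑ b, r * tripleChannel κ₁ κ₂ κ₃ (c (μ, m, b)) s) -
        ∑ μ, k * ∑ m, ∑ b, r * κ₁ (c (μ, m, b)) s.1 * κ₂ s.1 s.2.2 *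
          κ₃ s.2.2 (c (μ, m, g μ s.2.2 m)) s.2.1| ≤
      ∑ μ, k * ∑ m, ∑ b, 2 * (r * ∑ z, cascade κ₁ κ₂ (c (μ, m, b)) z *
        if g μ z m ≠ b then 1 else 0) := by
  -- Terms with a correctly decoded index cancel. Otherwise two PMFs in `y` are subtracted, and
  -- bounding the difference by their sum produces the factor 2.
  have hpt : ∀ s : X × Y × Z,
      |(∑ μ, k * ∑ m, ∑ b, r * tripleChannel κ₁ κ₂ κ₃ (c (μ, m, b)) s) -
        ∑ μ, k * ∑ m, ∑ b, r * κ₁ (c (μ, m, b)) s.1 * κ₂ s.1 s.2.2 *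
          κ₃ s.2.2 (c (μ, m, g μ s.2.2 m)) s.2.1| ≤
      ∑ μ, k * ∑ m, ∑ b, r * κ₁ (c (μ, m, b)) s.1 * κ₂ s.1 s.2.2 *
        ((κ₃ s.2.2 (c (μ, m, b)) s.2.1 + κ₃ s.2.2 (c (μ, m, g μ s.2.2 m)) s.2.1) *
          if g μ s.2.2 m ≠ b then 1 else 0) := by
    rintro ⟨x, y, z⟩
    dsimp only
    rw [← Finset.sum_sub_distrib]
    refine (Finset.abs_sum_le_sum_abs _ _).trans (Finset.sum_le_sum fun μ _ => ?_)
    rw [← mul_sub, abs_mul, abs_of_nonneg hk, ← Finset.sum_sub_distrib]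
    refine mul_le_mul_of_nonneg_left ((Finset.abs_sum_le_sum_abs _ _).trans
      (Finset.sum_le_sum fun m _ => ?_)) hk
    rw [← Finset.sum_sub_distrib]
    refine (Finset.abs_sum_le_sum_abs _ _).trans (Finset.sum_le_sum fun b _ => ?_)
    have hn : 0 ≤ r * κ₁ (c (μ, m, b)) x * κ₂ x z :=
      mul_nonneg (mul_nonneg hr ((h₁ _).1 _)) ((h₂ _).1 _)
    rw [tripleChannel, ← mul_assoc, ← mul_assoc, ← mul_sub, abs_mul, abs_of_nonneg hn]
    refine mul_le_mul_of_nonneg_left ?_ hn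
    split_ifs with hg
    · rw [mul_one]
      refine (abs_sub _ _).trans ?_
      rw [abs_of_nonneg ((h₃ _ _).1 _), abs_of_nonneg ((h₃ _ _).1 _)]
    · rw [not_not] at hg
      simp [hg]
  refine (Finset.sum_le_sum fun s _ => hpt s).trans (le_of_eq ?_)
  rw [Finset.sum_comm]
  refine Finset.sum_congr rfl fun μ _ => ?_
  rw [← Finset.mul_sum, Finset.sum_comm]
  congr 1
  refine Finset.sum_congr rfl fun m _ => ?_
  rw [Finset.sum_comm]
  refine Finset.sum_congr rfl fun b _ => ?_
  rw [Fintype.sum_prod_type]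
  simp only [cascade, Finset.sum_mul, Finset.mul_sum]
  rw [Finset.sum_comm (s := (Finset.univ : Finset Z))]
  refine Finset.sum_congr rfl fun x _ => ?_
  rw [Fintype.sum_prod_type_right]
  refine Finset.sum_congr rfl fun z _ => ?_
  by_cases hg : g μ z m = b
  · simp [hg]
  · simp only [ne_eq, hg, not_false_eq_true, if_true, mul_one]
    rw [← Finset.mul_sum, Finset.sum_add_distrib, (h₃ _ _).2, (h₃ _ _).2]
    ring

variable [Fintype W]

lemma iidE_average_le {ι A : Type*} [Fintype ι] [DecidableEq ι] [Fintype A] {p : A → ℝ}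
    (F : S → M → β → (ι → A) → ℝ) {T k r : ℝ} (hF : ∀ μ m b, iidE p (F μ m b) ≤ T)
    (hk0 : 0 ≤ k) (hr0 : 0 ≤ r) (hk : k * Fintype.card S = 1)
    (hr : r * (Fintype.card M * Fintype.card β) = 1) :
    iidE p (fun c => ∑ μ, k * ∑ m, ∑ b, 2 * (r * F μ m b c)) ≤ 2 * T := by
  rw [iidE_sum]
  simp only [iidE_mul_left, iidE_sum]
  have h : ∀ μ, k * ∑ m, ∑ b, 2 * (r * iidE p (F μ m b)) ≤ k * ∑ _m : M, ∑ _b : β, 2 * (r * T) :=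
    fun μ => mul_le_mul_of_nonneg_left (Finset.sum_le_sum fun m _ => Finset.sum_le_sum fun b _ =>
      mul_le_mul_of_nonneg_left (mul_le_mul_of_nonneg_left (hF μ m b) hr0) zero_le_two) hk0
  refine (Finset.sum_le_sum fun μ _ => h μ).trans (le_of_eq ?_)
  simp only [Finset.sum_const, Finset.card_univ, nsmul_eq_mul]
  linear_combination (2 * T * (r * (Fintype.card M * Fintype.card β))) * hk + 2 * T * hr

/-- One-shot achievability: likelihood encoding and threshold decoding with a random codebook. -/
theorem one_shot [Nonempty S] [Nonempty M] [Inhabited β] {p : W → ℝ} (hp : p ∈ stdSimplex ℝ W)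
    {κ₁ : W → X → ℝ} {κ₂ : X → Z → ℝ} {κ₃ : Z → W → Y → ℝ}
    (h₁ : ∀ w, κ₁ w ∈ stdSimplex ℝ X) (h₂ : ∀ x, κ₂ x ∈ stdSimplex ℝ Z)
    (h₃ : ∀ z w, κ₃ z w ∈ stdSimplex ℝ Y) {t₁ t₂ t₃ : ℝ} (ht₁ : 0 ≤ t₁) (ht₂ : 0 < t₂)
    (ht₃ : 0 ≤ t₃) :
    ∃ (enc : S → X → M → ℝ) (dec : S → Z → M → Y → ℝ),
      (∀ μ x, enc μ x ∈ stdSimplex ℝ M) ∧ (∀ μ z m, dec μ z m ∈ stdSimplex ℝ Y) ∧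
      ∑ s : X × Y × Z, |outPMF p (tripleChannel κ₁ κ₂ κ₃) s - ∑ μ, (Fintype.card S : ℝ)⁻¹ *
          ∑ m, outPMF p κ₁ s.1 * κ₂ s.1 s.2.2 * enc μ s.1 m * dec μ s.2.2 m s.2.1| ≤
        (2 * tailAbove p (tripleChannel κ₁ κ₂ κ₃) t₃ +
          √(t₃ / (Fintype.card S * (Fintype.card M * Fintype.card β)))) +
        2 * (tailBelow p (cascade κ₁ κ₂) t₂ + ((Fintype.card β : ℝ) - 1) / t₂) +
        (2 * tailAbove p κ₁ t₁ + √(t₁ / (Fintype.card M * Fintype.card β))) := by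
  classical
  have hp0 := hp.1
  have hp1 := hp.2
  have hS : (0 : ℝ) < Fintype.card S := by exact_mod_cast Fintype.card_pos
  have hM : (0 : ℝ) < Fintype.card M := by exact_mod_cast Fintype.card_pos
  have hβ : (0 : ℝ) < Fintype.card β := by exact_mod_cast Fintype.card_pos
  set k : ℝ := (Fintype.card S : ℝ)⁻¹ with hk
  set r : ℝ := ((Fintype.card M : ℝ) * Fintype.card β)⁻¹ with hr
  have hk0 : 0 ≤ k := by positivity
  have hr0 : 0 ≤ r := by positivity
  have hT0 : ∀ w s, 0 ≤ tripleChannel κ₁ κ₂ κ₃ w s := fun w s =>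
    mul_nonneg (mul_nonneg ((h₁ _).1 _) ((h₂ _).1 _)) ((h₃ _ _).1 _)
  have hC0 : ∀ w s, 0 ≤ cascade κ₁ κ₂ w s := fun w s =>
    Finset.sum_nonneg fun x _ => mul_nonneg ((h₁ _).1 _) ((h₂ _).1 _)
  set g : (S × M × β → W) → S → Z → M → β := fun c μ z m =>
    thresholdDec p (cascade κ₁ κ₂) t₂ (fun b => c (μ, m, b)) z with hg
  set E₁ : (S × M × β → W) → ℝ := fun c => ∑ μ, k * ∑ x,
    |r * ∑ b : M × β, κ₁ (c (μ, b)) x - outPMF p κ₁ x|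
  set E₂ : (S × M × β → W) → ℝ := fun c => ∑ μ, k * ∑ m, ∑ b, 2 * (r *
    ∑ z, cascade κ₁ κ₂ (c (μ, m, b)) z * if g c μ z m ≠ b then 1 else 0)
  set E₃ : (S × M × β → W) → ℝ := fun c => ∑ s, |((Finset.univ : Finset (S × M × β)).card : ℝ)⁻¹ *
    ∑ i ∈ Finset.univ, tripleChannel κ₁ κ₂ κ₃ (c i) s - outPMF p (tripleChannel κ₁ κ₂ κ₃) s|
  have hE₁ : iidE p E₁ ≤ 2 * tailAbove p κ₁ t₁ + √(t₁ / (Fintype.card M * Fintype.card β)) := by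
    have h : ∀ μ : S, iidE p (fun c : S × M × β → W => ∑ x,
        |r * ∑ b : M × β, κ₁ (c (μ, b)) x - outPMF p κ₁ x|) ≤
        2 * tailAbove p κ₁ t₁ + √(t₁ / (Fintype.card M * Fintype.card β)) := by
      intro μ
      -- The encoder knows `μ`, so the source has to be covered by the codewords of that `μ` alone;
      -- hence the common randomness does not help in this term.
      have := soft_covering (ι := S × M × β) hp0 hp1 (fun w => (h₁ w).1) (fun w => (h₁ w).2)
        ((Finset.univ : Finset (M × β)).map ⟨fun b => (μ, b), fun _ _ h => (Prod.mk.inj h).2⟩)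
        (Finset.univ_nonempty.map) ht₁
      simp only [Finset.card_map, Finset.sum_map, Finset.card_univ, Fintype.card_prod,
        Nat.cast_mul] at this
      exact this
    rw [iidE_sum]
    simp only [iidE_mul_left]
    refine (Finset.sum_le_sum fun μ _ => mul_le_mul_of_nonneg_left (h μ) hk0).trans (le_of_eq ?_)
    rw [Finset.sum_const, Finset.card_univ, nsmul_eq_mul, hk, mul_inv_cancel_left₀ hS.ne']
  have hE₂ : iidE p E₂ ≤
      2 * (tailBelow p (cascade κ₁ κ₂) t₂ + ((Fintype.card β : ℝ) - 1) / t₂) := by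
    have h : ∀ (μ : S) (m : M) (b : β), iidE p (fun c : S × M × β → W =>
        ∑ z, cascade κ₁ κ₂ (c (μ, m, b)) z * if g c μ z m ≠ b then 1 else 0) ≤
        tailBelow p (cascade κ₁ κ₂) t₂ + ((Fintype.card β : ℝ) - 1) / t₂ := fun μ m b =>
      iidE_thresholdDec_error_le (ι := S × M × β) hp0 hp1 hC0 (sum_cascade h₁ h₂) ht₂
        (e := fun b => (μ, m, b)) (fun _ _ h => (Prod.mk.inj (Prod.mk.inj h).2).2) b
    exact iidE_average_le (ι := S × M × β) (A := W) _ h hk0 hr0 (inv_mul_cancel₀ hS.ne')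
      (inv_mul_cancel₀ (mul_pos hM hβ).ne')
  have hE₃ : iidE p E₃ ≤ 2 * tailAbove p (tripleChannel κ₁ κ₂ κ₃) t₃ +
      √(t₃ / (Fintype.card S * (Fintype.card M * Fintype.card β))) := by
    have := soft_covering (ι := S × M × β) hp0 hp1 hT0 (sum_tripleChannel h₁ h₂ h₃)
      Finset.univ Finset.univ_nonempty ht₃
    simpa only [E₃, Finset.card_univ, Fintype.card_prod, Nat.cast_mul] using this
  -- Derandomization is applied to the sum, so that one codebook serves all three errors.
  obtain ⟨c, hc⟩ := exists_le_iidE hp0 hp1 (fun c => E₃ c + E₂ c + E₁ c)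
  rw [iidE_add, iidE_add] at hc
  choose l hl hal using fun (μ : S) (x : X) =>
    exists_normalized (a := fun b : M × β => κ₁ (c (μ, b)) x) (fun b => (h₁ _).1 _)
  -- The encoder samples `(m, b)` from the posterior and forgets `b`; the decoder estimates `b` and
  -- feeds the estimated codeword to `κ₃`.
  refine ⟨fun μ x m => ∑ b, l μ x (m, b), fun μ z m => κ₃ z (c (μ, m, g c μ z m)),
    fun μ x => ⟨fun m => Finset.sum_nonneg fun b _ => (hl μ x).1 _, ?_⟩,
    fun μ z m => h₃ _ _, le_trans ?_ (hc.trans (add_le_add (add_le_add hE₃ hE₂) hE₁))⟩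
  · rw [← Fintype.sum_prod_type]
    exact (hl μ x).2
  have e₁ := likelihood_encoder_error (pX := outPMF p κ₁) (a := fun μ b x => κ₁ (c (μ, b)) x) h₂
    (d := fun μ z m => κ₃ z (c (μ, m, g c μ z m))) (fun μ z m => h₃ _ _) hl hal hk0 (r := r)
  have e₂ := decoded_index_error h₁ h₂ h₃ c (g c) hk0 hr0
  have e₃ : ∑ s, |outPMF p (tripleChannel κ₁ κ₂ κ₃) s -
      ∑ μ, k * ∑ m, ∑ b, r * tripleChannel κ₁ κ₂ κ₃ (c (μ, m, b)) s| = E₃ c := by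
    refine Finset.sum_congr rfl fun s _ => ?_
    rw [abs_sub_comm]
    congr 2
    simp only [Finset.card_univ, Fintype.card_prod, Fintype.sum_prod_type, Finset.mul_sum, hk, hr,
      Nat.cast_mul, mul_inv, mul_assoc]
  rw [← e₃]
  refine le_trans ?_ (add_le_add (add_le_add le_rfl e₂) e₁)
  rw [← Finset.sum_add_distrib, ← Finset.sum_add_distrib]
  refine Finset.sum_le_sum fun s _ => ?_
  exact (abs_sub_le _ _ _).trans (add_le_add (abs_sub_le _ _ _) le_rfl)

end OneShot

/-! ### Memoryless extensions and concentration of the information density. -/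

section Block

variable {W V X Y Z : Type*} [Fintype W] {n : ℕ}

/-- The memoryless extension of the channel `κ` to `n` uses. -/
def blockChannel (n : ℕ) (κ : W → V → ℝ) (w : Fin n → W) (v : Fin n → V) : ℝ :=
  ∏ i, κ (w i) (v i)

/-- The `n`-fold product of a PMF. -/
def blockPMF (n : ℕ) (p : W → ℝ) (w : Fin n → W) : ℝ := ∏ i, p (w i)

lemma blockPMF_mem {p : W → ℝ} (hp : p ∈ stdSimplex ℝ W) :
    blockPMF n p ∈ stdSimplex ℝ (Fin n → W) := by
  refine ⟨fun w => Finset.prod_nonneg fun i _ => hp.1 _, ?_⟩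
  have := Finset.prod_univ_sum (fun _ : Fin n => (Finset.univ : Finset W)) (fun _ => p)
  simpa [blockPMF, hp.2] using this.symm

lemma blockChannel_mem [Fintype V] {W : Type*} {κ : W → V → ℝ} (h : ∀ w, κ w ∈ stdSimplex ℝ V)
    (w : Fin n → W) : blockChannel n κ w ∈ stdSimplex ℝ (Fin n → V) := by
  refine ⟨fun w => Finset.prod_nonneg fun i _ => (h _).1 _, ?_⟩
  have := Finset.prod_univ_sum (fun _ : Fin n => (Finset.univ : Finset V)) (fun i => κ (w i))
  simpa [blockChannel, (h _).2] using this.symm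

lemma outPMF_block (p : W → ℝ) (κ : W → V → ℝ) (v : Fin n → V) :
    outPMF (blockPMF n p) (blockChannel n κ) v = ∏ i, outPMF p κ (v i) := by
  simp only [outPMF, Finset.prod_univ_sum, blockPMF, blockChannel, ← Finset.prod_mul_distrib]
  simp

lemma cascade_block [Fintype X] {W : Type*} (κ₁ : W → X → ℝ) (κ₂ : X → Z → ℝ) :
    cascade (blockChannel n κ₁) (blockChannel n κ₂) = blockChannel n (cascade κ₁ κ₂) := by
  funext w z
  simp only [cascade, Finset.prod_univ_sum, blockChannel, ← Finset.prod_mul_distrib]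
  simp

lemma log_block {p : W → ℝ} {κ : W → V → ℝ} {w : Fin n → W} {v : Fin n → V}
    (hκ : ∀ i, 0 < κ (w i) (v i)) (ho : ∀ i, 0 < outPMF p κ (v i)) :
    ∑ i, Real.log (κ (w i) (v i) / outPMF p κ (v i)) =
      Real.log (blockChannel n κ w v) - Real.log (outPMF (blockPMF n p) (blockChannel n κ) v) := by
  rw [outPMF_block, blockChannel, Real.log_prod fun i _ => (hκ i).ne',
    Real.log_prod fun i _ => (ho i).ne', ← Finset.sum_sub_distrib]
  exact Finset.sum_congr rfl fun i _ => Real.log_div (hκ i).ne' (ho i).ne'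

lemma tailAbove_comp_equiv {U V : Type*} [Fintype U] [Fintype V] (e : U ≃ V) (p : W → ℝ)
    (κ : W → V → ℝ) (t : ℝ) : tailAbove p (fun w u => κ w (e u)) t = tailAbove p κ t := by
  classical
  refine Finset.sum_congr rfl fun w _ => ?_
  rw [← e.sum_comp]
  rfl

/-- The mutual information, in nats, between the input and the output of the channel `κ`. -/
noncomputable def channelInfo [Fintype V] (p : W → ℝ) (κ : W → V → ℝ) : ℝ :=
  ∑ a : W × V, p a.1 * κ a.1 a.2 * Real.log (κ a.1 a.2 / outPMF p κ a.2)

/-- The variance of the information density of the channel `κ`. -/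
noncomputable def channelVar [Fintype V] (p : W → ℝ) (κ : W → V → ℝ) : ℝ :=
  ∑ a : W × V, p a.1 * κ a.1 a.2 *
    (Real.log (κ a.1 a.2 / outPMF p κ a.2) - channelInfo p κ) ^ 2

variable [Fintype V]

lemma joint_mem {p : W → ℝ} (hp : p ∈ stdSimplex ℝ W) {κ : W → V → ℝ}
    (h : ∀ w, κ w ∈ stdSimplex ℝ V) :
    (fun a : W × V => p a.1 * κ a.1 a.2) ∈ stdSimplex ℝ (W × V) := by
  refine ⟨fun a => mul_nonneg (hp.1 _) ((h _).1 _), ?_⟩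
  simp [Fintype.sum_prod_type, ← Finset.mul_sum, (h _).2, hp.2]

/-- Chebyshev's inequality for the information density under the joint law. The event is kept
abstract so that both tails are instances, and the deviation need only be checked where all factors
are positive, since other sequences have probability zero. -/
lemma sum_block_le {p : W → ℝ} (hp : p ∈ stdSimplex ℝ W) {κ : W → V → ℝ}
    (h : ∀ w, κ w ∈ stdSimplex ℝ V) {δ : ℝ} (hδ : 0 < δ) (hn : 0 < n)
    (P : (Fin n → W) → (Fin n → V) → Prop) [∀ w v, Decidable (P w v)]
    (hP : ∀ w v, P w v → (∀ i, 0 < κ (w i) (v i)) → (∀ i, 0 < outPMF p κ (v i)) →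
      n * δ < |∑ i, Real.log (κ (w i) (v i) / outPMF p κ (v i)) - n * channelInfo p κ|) :
    ∑ w, blockPMF n p w * ∑ v, (if P w v then blockChannel n κ w v else 0) ≤
      channelVar p κ / (n * δ ^ 2) := by
  refine le_trans ?_ (chebyshev (joint_mem hp h).1 (joint_mem hp h).2
    (g := fun a => Real.log (κ a.1 a.2 / outPMF p κ a.2)) (m := channelInfo p κ) rfl hδ hn)
  have e : ∑ w, blockPMF n p w * ∑ v, (if P w v then blockChannel n κ w v else 0) =
      ∑ c : Fin n → W × V, (∏ i, p (c i).1 * κ (c i).1 (c i).2) *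
        if P (fun i => (c i).1) (fun i => (c i).2) then 1 else 0 := by
    rw [← (Equiv.arrowProdEquivProdArrow (Fin n) (fun _ => W) (fun _ => V)).symm.sum_comp,
      Fintype.sum_prod_type]
    simp only [Finset.mul_sum]
    refine Finset.sum_congr rfl fun w _ => Finset.sum_congr rfl fun v _ => ?_
    simp [Finset.prod_mul_distrib, blockPMF, blockChannel, mul_ite]
  rw [e]
  refine Finset.sum_le_sum fun c _ => ?_
  have hterm : ∀ i, 0 ≤ p (c i).1 * κ (c i).1 (c i).2 := fun i => (joint_mem hp h).1 (c i)
  by_cases h0 : ∏ i, p (c i).1 * κ (c i).1 (c i).2 = 0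
  · simp [h0]
  refine mul_le_mul_of_nonneg_left ?_ (Finset.prod_nonneg fun i _ => hterm i)
  have hpos : ∀ i, 0 < p (c i).1 * κ (c i).1 (c i).2 := fun i =>
    lt_of_le_of_ne (hterm i) (Ne.symm (Finset.prod_ne_zero_iff.1 h0 i (Finset.mem_univ i)))
  dsimp only
  by_cases hPc : P (fun i => (c i).1) (fun i => (c i).2)
  · have hκ : ∀ i, 0 < κ (c i).1 (c i).2 := fun i => pos_of_mul_pos_right (hpos i) (hp.1 _)
    have ho : ∀ i, 0 < outPMF p κ (c i).2 := fun i =>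
      (hpos i).trans_le (Finset.single_le_sum (f := fun w => p w * κ w (c i).2)
        (fun w _ => mul_nonneg (hp.1 w) ((h w).1 _)) (Finset.mem_univ (c i).1))
    rw [if_pos hPc, if_pos (hP _ _ hPc hκ ho)]
  · rw [if_neg hPc]
    split_ifs <;> norm_num

lemma tailAbove_block_le {p : W → ℝ} (hp : p ∈ stdSimplex ℝ W) {κ : W → V → ℝ}
    (h : ∀ w, κ w ∈ stdSimplex ℝ V) {δ : ℝ} (hδ : 0 < δ) (hn : 0 < n) :
    tailAbove (blockPMF n p) (blockChannel n κ) (Real.exp (n * (channelInfo p κ + δ))) ≤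
      channelVar p κ / (n * δ ^ 2) := by
  classical
  refine sum_block_le hp h hδ hn _ fun w v hlt hκ ho => ?_
  have ho' : 0 < outPMF (blockPMF n p) (blockChannel n κ) v := by
    rw [outPMF_block]; exact Finset.prod_pos fun i _ => ho i
  rw [log_block hκ ho, lt_abs]
  left
  have := Real.log_lt_log (mul_pos (Real.exp_pos _) ho') hlt
  rw [Real.log_mul (Real.exp_pos _).ne' ho'.ne', Real.log_exp] at this
  linarith

/-- The event is a non-strict inequality whereas `sum_block_le` asks for a deviation strictly above
`n * δ`; the margin `2 * δ` in the exponent supplies the strictness. -/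
lemma tailBelow_block_le {p : W → ℝ} (hp : p ∈ stdSimplex ℝ W) {κ : W → V → ℝ}
    (h : ∀ w, κ w ∈ stdSimplex ℝ V) {δ : ℝ} (hδ : 0 < δ) (hn : 0 < n) :
    tailBelow (blockPMF n p) (blockChannel n κ) (Real.exp (n * (channelInfo p κ - 2 * δ))) ≤
      channelVar p κ / (n * δ ^ 2) := by
  classical
  refine sum_block_le hp h hδ hn _ fun w v hlt hκ ho => ?_
  have hn' : (0 : ℝ) < n := by exact_mod_cast hn
  have ho' : 0 < outPMF (blockPMF n p) (blockChannel n κ) v := by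
    rw [outPMF_block]; exact Finset.prod_pos fun i _ => ho i
  have hκ' : 0 < blockChannel n κ w v := Finset.prod_pos fun i _ => hκ i
  rw [log_block hκ ho, lt_abs]
  right
  have := Real.log_le_log hκ' hlt
  rw [Real.log_mul (Real.exp_pos _).ne' ho'.ne', Real.log_exp] at this
  nlinarith [mul_pos hn' hδ]

/-- A triple of sequences as a sequence of triples. -/
def tripleEquiv (n : ℕ) (X Y Z : Type*) :
    (Fin n → X) × (Fin n → Y) × (Fin n → Z) ≃ (Fin n → X × Y × Z) where
  toFun s i := (s.1 i, s.2.1 i, s.2.2 i)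
  invFun c := (fun i => (c i).1, fun i => (c i).2.1, fun i => (c i).2.2)
  left_inv _ := rfl
  right_inv _ := rfl

lemma tripleChannel_block {W : Type*} (κ₁ : W → X → ℝ) (κ₂ : X → Z → ℝ) (κ₃ : Z → W → Y → ℝ) :
    tripleChannel (blockChannel n κ₁) (blockChannel n κ₂)
      (fun z w => blockChannel n (fun a : Z × W => κ₃ a.1 a.2) (fun i => (z i, w i))) =
    fun w s => blockChannel n (tripleChannel κ₁ κ₂ κ₃) w (tripleEquiv n X Y Z s) := by
  funext w s
  simp [tripleChannel, blockChannel, Finset.prod_mul_distrib, tripleEquiv]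

end Block

/-- Rounding a number that is at least 1 down costs at most a factor 2, which is negligible against
exponential decay. -/
lemma half_exp_le_floor {x : ℝ} (hx : 0 ≤ x) : Real.exp x / 2 ≤ (⌊Real.exp x⌋₊ : ℝ) := by
  have h1 : 1 ≤ ⌊Real.exp x⌋₊ := Nat.le_floor (by simpa using hx)
  have h2 := Nat.lt_floor_add_one (Real.exp x)
  have h3 : (1 : ℝ) ≤ ⌊Real.exp x⌋₊ := by exact_mod_cast h1
  linarith

/-! ### Achievability for given kernels. -/

section Achievability

variable {W X Y Z : Type*} [Fintype W] [Fintype X] [Fintype Y] [Fintype Z]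

/-- The one-shot code for the block channels, with about `exp (n * I₂)` unsent indices. Each
likelihood threshold sits slightly on the far side of its mutual information, so the tails vanish,
while the codebook sizes beat the thresholds by a factor exponential in `n`. -/
theorem achievable_of_kernels {p : X × Y × Z → ℝ} {pW : W → ℝ} (hpW : pW ∈ stdSimplex ℝ W)
    {κ₁ : W → X → ℝ} {κ₂ : X → Z → ℝ} {κ₃ : Z → W → Y → ℝ}
    (h₁ : ∀ w, κ₁ w ∈ stdSimplex ℝ X) (h₂ : ∀ x, κ₂ x ∈ stdSimplex ℝ Z)
    (h₃ : ∀ z w, κ₃ z w ∈ stdSimplex ℝ Y)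
    (hp : p = outPMF pW (tripleChannel κ₁ κ₂ κ₃)) {R C : ℝ} (hR : 0 ≤ R) (hC : 0 ≤ C)
    (hI₁ : channelInfo pW κ₁ - channelInfo pW (cascade κ₁ κ₂) ≤ R * Real.log 2)
    (hI₃ : channelInfo pW (tripleChannel κ₁ κ₂ κ₃) - channelInfo pW (cascade κ₁ κ₂) ≤
      (R + C) * Real.log 2) :
    (R, C) ∈ achievableRegion p := by
  intro ε hε
  have hl2 : 0 < Real.log 2 := Real.log_pos one_lt_two
  set I₁ := channelInfo pW κ₁ with hI₁'
  set I₂ := channelInfo pW (cascade κ₁ κ₂) with hI₂'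
  set I₃ := channelInfo pW (tripleChannel κ₁ κ₂ κ₃) with hI₃'
  set v₁ := channelVar pW κ₁
  set v₂ := channelVar pW (cascade κ₁ κ₂)
  set v₃ := channelVar pW (tripleChannel κ₁ κ₂ κ₃)
  -- The rate slack `ε` has to pay `δ` for the covering threshold, `3 * δ` for the reduced number of
  -- unsent indices and `δ` for the decay; `8` leaves room to spare.
  obtain ⟨δ, hδ, hδε⟩ : ∃ δ : ℝ, 0 < δ ∧ 8 * δ = ε * Real.log 2 :=
    ⟨ε * Real.log 2 / 8, by positivity, by ring⟩
  have hlim : Tendsto (fun n : ℕ => 1 / 2 *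
      ((2 * (v₃ / (n * δ ^ 2)) + √(4 * Real.exp (-(n * δ)))) +
        2 * (v₂ / (n * δ ^ 2) + Real.exp (-(n * δ))) +
        (2 * (v₁ / (n * δ ^ 2)) + √(4 * Real.exp (-(n * δ)))))) atTop (𝓝 0) := by
    have hnδ : Tendsto (fun n : ℕ => (n : ℝ) * δ) atTop atTop :=
      tendsto_natCast_atTop_atTop.atTop_mul_const hδ
    have hv : ∀ v : ℝ, Tendsto (fun n : ℕ => v / (n * δ ^ 2)) atTop (𝓝 0) := fun v =>
      tendsto_const_nhds.div_atTop (tendsto_natCast_atTop_atTop.atTop_mul_const (by positivity))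
    have he : Tendsto (fun n : ℕ => Real.exp (-(n * δ))) atTop (𝓝 0) :=
      Real.tendsto_exp_neg_atTop_nhds_zero.comp hnδ
    have hs : Tendsto (fun n : ℕ => √(4 * Real.exp (-(n * δ)))) atTop (𝓝 0) := by
      simpa using (he.const_mul 4).sqrt
    have := (((((hv v₃).const_mul 2).add hs).add (((hv v₂).add he).const_mul 2)).add
      (((hv v₁).const_mul 2).add hs)).const_mul (1 / 2)
    simpa using this
  obtain ⟨N, hN⟩ := eventually_atTop.1 (hlim.eventually (ge_mem_nhds hε))
  refine ⟨max N 1, fun n hn => ?_⟩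
  have hn0 : 0 < n := (le_max_right N 1).trans hn
  have hn' : (0 : ℝ) < n := by exact_mod_cast hn0
  have hNn := hN n ((le_max_left N 1).trans hn)
  have hK2 : (2 : ℝ) ^ ((n : ℝ) * C) = Real.exp (n * (C * Real.log 2)) := by
    rw [Real.rpow_def_of_pos two_pos]; ring_nf
  set K := ⌊(2 : ℝ) ^ ((n : ℝ) * C)⌋₊ with hK
  set r := (R + ε) * Real.log 2 with hr
  have hr0 : 0 ≤ r := by positivity
  set Θ := ⌊Real.exp (n * r)⌋₊ with hΘ
  have hKge : Real.exp (n * (C * Real.log 2)) / 2 ≤ K := by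
    rw [hK, hK2]; exact half_exp_le_floor (by positivity)
  have hΘge : Real.exp (n * r) / 2 ≤ Θ := half_exp_le_floor (by positivity)
  -- Rounding up keeps `B` positive even when the exponent is negative. The decoding error involves
  -- only `B - 1`, the number of wrong indices, so it is still small in that case.
  set B := ⌈Real.exp (n * (I₂ - 3 * δ))⌉₊ with hB
  have hBge : Real.exp (n * (I₂ - 3 * δ)) ≤ B := Nat.le_ceil _
  have hBle : (B : ℝ) - 1 ≤ Real.exp (n * (I₂ - 3 * δ)) := by
    have := Nat.ceil_lt_add_one (Real.exp_pos (n * (I₂ - 3 * δ))).le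
    rw [← hB] at this
    linarith
  have hK0 : (0 : ℝ) < K := lt_of_lt_of_le (by positivity) hKge
  have hΘ0 : (0 : ℝ) < Θ := lt_of_lt_of_le (by positivity) hΘge
  have hB0 : (0 : ℝ) < B := lt_of_lt_of_le (Real.exp_pos _) hBge
  have : NeZero K := ⟨by rintro h; simp [h] at hK0⟩
  have : NeZero Θ := ⟨by rintro h; simp [h] at hΘ0⟩
  have : NeZero B := ⟨by rintro h; simp [h] at hB0⟩
  obtain ⟨enc, dec, henc, hdec, hle⟩ := one_shot (S := Fin K) (M := Fin Θ) (β := Fin B)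
    (blockPMF_mem (n := n) hpW) (κ₁ := blockChannel n κ₁) (κ₂ := blockChannel n κ₂)
    (κ₃ := fun z w => blockChannel n (fun a : Z × W => κ₃ a.1 a.2) (fun i => (z i, w i)))
    (blockChannel_mem h₁) (blockChannel_mem h₂)
    (fun z w => blockChannel_mem (fun a : Z × W => h₃ a.1 a.2) _)
    (Real.exp_pos (n * (I₁ + δ))).le (Real.exp_pos (n * (I₂ - 2 * δ)))
    (Real.exp_pos (n * (I₃ + δ))).le
  refine ⟨Θ, ⟨enc, henc, dec, hdec⟩, ?_, ?_⟩
  · have hsrc : ∀ (x : Fin n → X) (z : Fin n → Z), iidSource p x z =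
        outPMF (blockPMF n pW) (blockChannel n κ₁) x * blockChannel n κ₂ x z := by
      intro x z
      rw [outPMF_block, blockChannel, ← Finset.prod_mul_distrib]
      refine Finset.prod_congr rfl fun i _ => ?_
      simp only [hp, outPMF, tripleChannel, Finset.sum_mul]
      rw [Finset.sum_comm]
      refine Finset.sum_congr rfl fun w _ => ?_
      rw [← Finset.mul_sum, ← Finset.mul_sum, (h₃ _ _).2]
      ring
    have htgt : ∀ s, iidPMF p n s = outPMF (blockPMF n pW) (tripleChannel (blockChannel n κ₁)
        (blockChannel n κ₂) (fun z w => blockChannel n (fun a : Z × W => κ₃ a.1 a.2)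
          (fun i => (z i, w i)))) s := by
      intro s
      rw [tripleChannel_block]
      exact (by rw [hp]; rfl : iidPMF p n s = ∏ i, outPMF pW (tripleChannel κ₁ κ₂ κ₃)
        (tripleEquiv n X Y Z s i)).trans (outPMF_block _ _ _).symm
    rw [tripleChannel_block, cascade_block,
      tailAbove_comp_equiv (tripleEquiv n X Y Z) (blockPMF n pW)
        (blockChannel n (tripleChannel κ₁ κ₂ κ₃))] at hle
    have T₁ := tailAbove_block_le hpW h₁ hδ hn0
    have T₂ := tailBelow_block_le hpW (κ := cascade κ₁ κ₂) (fun w =>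
      ⟨fun z => Finset.sum_nonneg fun x _ => mul_nonneg ((h₁ _).1 _) ((h₂ _).1 _),
        sum_cascade h₁ h₂ w⟩) hδ hn0
    have T₃ := tailAbove_block_le hpW (κ := tripleChannel κ₁ κ₂ κ₃) (fun w =>
      ⟨fun s => mul_nonneg (mul_nonneg ((h₁ _).1 _) ((h₂ _).1 _)) ((h₃ _ _).1 _),
        sum_tripleChannel h₁ h₂ h₃ w⟩) hδ hn0
    have hrate₁ : I₁ + δ ≤ r + (I₂ - 3 * δ) - δ := by
      rw [hr, add_mul, ← hδε]; linarith
    have hrate₃ : I₃ + δ ≤ C * Real.log 2 + r + (I₂ - 3 * δ) - δ := by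
      rw [hr, add_mul, ← hδε]; linarith
    -- The factor 4 is the price of rounding both `K` and `Θ`, as needed in `S₃`. Here 2 would do;
    -- the same constant is used in both.
    have S₁ : Real.exp (n * (I₁ + δ)) / (Θ * B) ≤ 4 * Real.exp (-(n * δ)) := by
      rw [div_le_iff₀ (by positivity)]
      calc Real.exp (n * (I₁ + δ)) ≤ Real.exp (n * (r + (I₂ - 3 * δ) - δ)) := by gcongr
        _ = Real.exp (-(n * δ)) * (Real.exp (n * r) * Real.exp (n * (I₂ - 3 * δ))) := by
          rw [← Real.exp_add, ← Real.exp_add]; ring_nf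
        _ ≤ Real.exp (-(n * δ)) * (Real.exp (n * r) * Real.exp (n * (I₂ - 3 * δ))) * 2 := by
          nlinarith [mul_pos (Real.exp_pos (-(n * δ))) (mul_pos (Real.exp_pos (n * r))
            (Real.exp_pos (n * (I₂ - 3 * δ))))]
        _ = 4 * Real.exp (-(n * δ)) * (Real.exp (n * r) / 2 * Real.exp (n * (I₂ - 3 * δ))) := by
          ring
        _ ≤ _ := by gcongr
    have S₃ : Real.exp (n * (I₃ + δ)) / (K * (Θ * B)) ≤ 4 * Real.exp (-(n * δ)) := by
      rw [div_le_iff₀ (by positivity)]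
      calc Real.exp (n * (I₃ + δ)) ≤
          Real.exp (n * (C * Real.log 2 + r + (I₂ - 3 * δ) - δ)) := by gcongr
        _ = 4 * Real.exp (-(n * δ)) * (Real.exp (n * (C * Real.log 2)) / 2 *
            (Real.exp (n * r) / 2 * Real.exp (n * (I₂ - 3 * δ)))) := by
          rw [show n * (C * Real.log 2 + r + (I₂ - 3 * δ) - δ) = -(n * δ) +
            (n * (C * Real.log 2) + (n * r + n * (I₂ - 3 * δ))) by ring,
            Real.exp_add, Real.exp_add, Real.exp_add]; ring
        _ ≤ _ := by gcongr
    have S₂ : ((B : ℝ) - 1) / Real.exp (n * (I₂ - 2 * δ)) ≤ Real.exp (-(n * δ)) := by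
      rw [div_le_iff₀ (Real.exp_pos _), ← Real.exp_add]
      exact hBle.trans (le_of_eq (by ring_nf))
    refine le_trans ?_ hNn
    rw [tvDist]
    gcongr
    simp only [Fintype.card_fin] at hle
    refine le_trans (le_of_eq ?_) (hle.trans ?_)
    · refine Finset.sum_congr rfl fun s _ => ?_
      rw [htgt, tripleChannel_block]
      simp only [Code.inducedPMF, hsrc]
    · have Q₁ := Real.sqrt_le_sqrt S₁
      have Q₃ := Real.sqrt_le_sqrt S₃
      linarith
  · rw [one_div, inv_mul_le_iff₀ hn']
    rw [Real.logb, div_le_iff₀ hl2]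
    have := Real.log_le_log hΘ0 (Nat.floor_le (Real.exp_pos (n * r)).le)
    rw [Real.log_exp] at this
    linarith

end Achievability

/-! ### Strong subadditivity and mutual information. -/

section Information

variable {Ω A B D : Type*} [Fintype Ω]

lemma law_le_comp {q : Ω → ℝ} (hq : ∀ ω, 0 ≤ q ω) (f : Ω → A) (g : A → B) (a : A) :
    law q f a ≤ law q (fun ω => g (f ω)) (g a) := by
  classical
  refine Finset.sum_le_sum fun ω _ => ?_
  by_cases h : f ω = a
  · simp [h]
  · rw [if_neg h]
    split_ifs <;> simp [hq]

lemma law_swap (q : Ω → ℝ) (f : Ω → A) (g : Ω → B) (a : A) (b : B) :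
    law q (fun ω => (f ω, g ω)) (a, b) = law q (fun ω => (g ω, f ω)) (b, a) :=
  law_comp_injective q (fun ω => (g ω, f ω)) Prod.swap_injective (b, a)

lemma ent_swap [Fintype A] [Fintype B] (q : Ω → ℝ) (f : Ω → A) (g : Ω → B) :
    ent q (fun ω => (f ω, g ω)) = ent q (fun ω => (g ω, f ω)) :=
  ent_comp_injective q (fun ω => (g ω, f ω)) Prod.swap_injective

lemma mutualInfo_comm [Fintype A] [Fintype B] {q : Ω → ℝ} (hq : ∀ ω, 0 ≤ q ω) (f : Ω → A)
    (g : Ω → B) : mutualInfo q f g = mutualInfo q g f := by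
  rw [mutualInfo_eq hq, mutualInfo_eq hq, ent_swap q f g]
  ring

/-- Strong subadditivity of entropy. -/
lemma ent_submodular [Fintype A] [Fintype B] [Fintype D] {q : Ω → ℝ} (hq : ∀ ω, 0 ≤ q ω)
    (hq1 : ∑ ω, q ω = 1) (f : Ω → A) (g : Ω → B) (h : Ω → D) :
    ent q (fun ω => (f ω, g ω, h ω)) + ent q g ≤
      ent q (fun ω => (f ω, g ω)) + ent q (fun ω => (g ω, h ω)) := by
  -- The reference law is the Markov law with the given pair marginals. Values of `g` of probability
  -- zero get no mass, which is why only total mass at most one is claimed.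
  have h1 := ent_le_cross hq hq1 (fun ω => (f ω, g ω, h ω))
    (fun a => law q (fun ω => (f ω, g ω)) (a.1, a.2.1) / law q g a.2.1 *
      law q (fun ω => (g ω, h ω)) a.2)
    (fun a => mul_nonneg (div_nonneg (law_nonneg hq _ _) (law_nonneg hq _ _)) (law_nonneg hq _ _))
    (by
      rw [Fintype.sum_prod_type_right]
      simp only [← Finset.sum_mul, ← Finset.sum_div, sum_law_prod_left]
      calc _ ≤ ∑ y : B × D, law q (fun ω => (g ω, h ω)) y := by
            refine Finset.sum_le_sum fun y _ => ?_
            exact mul_le_of_le_one_left (law_nonneg hq _ _) (div_self_le_one _)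
        _ ≤ 1 := by rw [sum_law, hq1])
    (fun ω h0 => mul_pos (div_pos (law_pos hq (fun ω => (f ω, g ω)) h0) (law_pos hq g h0))
      (law_pos hq (fun ω => (g ω, h ω)) h0))
  have h2 : ∀ ω, q ω * Real.log (law q (fun ω => (f ω, g ω)) (f ω, g ω) / law q g (g ω) *
      law q (fun ω => (g ω, h ω)) (g ω, h ω)) =
      q ω * Real.log (law q (fun ω => (f ω, g ω)) (f ω, g ω)) - q ω * Real.log (law q g (g ω)) +
      q ω * Real.log (law q (fun ω => (g ω, h ω)) (g ω, h ω)) := by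
    intro ω
    by_cases h0 : q ω = 0
    · simp [h0]
    · have p1 := (law_pos hq (fun ω => (f ω, g ω)) h0).ne'
      have p2 := (law_pos hq g h0).ne'
      have p3 := (law_pos hq (fun ω => (g ω, h ω)) h0).ne'
      rw [Real.log_mul (div_ne_zero p1 p2) p3, Real.log_div p1 p2]
      ring
  simp only [h2, Finset.sum_add_distrib, Finset.sum_sub_distrib] at h1
  rw [ent_eq q g, ent_eq q (fun ω => (f ω, g ω)), ent_eq q (fun ω => (g ω, h ω))]
  linarith

/-- For a Markov chain `h - f - g`, one has `I(h; g) ≤ I(f; g)`. -/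
lemma mutualInfo_le_of_markov [Fintype A] [Fintype B] [Fintype D] {q : Ω → ℝ}
    (hq : ∀ ω, 0 ≤ q ω) (hq1 : ∑ ω, q ω = 1) {f : Ω → A} {g : Ω → B} {h : Ω → D}
    (hM : IsMarkovChain q h f g) : mutualInfo q g h ≤ mutualInfo q f g := by
  rw [mutualInfo_eq hq, mutualInfo_eq hq]
  have e1 := ent_markov hq hM
  have e2 := ent_submodular hq hq1 f h g
  have e3 : ent q (fun ω => (f ω, h ω, g ω)) = ent q (fun ω => (h ω, f ω, g ω)) :=
    ent_comp_injective q (fun ω => (h ω, f ω, g ω)) (g := fun a => (a.2.1, a.1, a.2.2))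
      (fun a b hab => by
        simp only [Prod.mk.injEq] at hab
        exact Prod.ext hab.2.1 (Prod.ext hab.1 hab.2.2))
  have e4 := ent_swap q h f
  have e5 := ent_swap q h g
  gcongr ?_ / _
  linarith

lemma mutualInfo_eq_channelInfo [Fintype A] [Fintype B] {q : Ω → ℝ} (f : Ω → A) (g : Ω → B)
    {p : B → ℝ} {κ : B → A → ℝ} (hκ : ∀ b, κ b ∈ stdSimplex ℝ A)
    (h : ∀ a b, law q (fun ω => (f ω, g ω)) (a, b) = p b * κ b a) :
    mutualInfo q f g * Real.log 2 = channelInfo p κ := by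
  have hf : ∀ a, law q f a = outPMF p κ a := fun a => by
    rw [← sum_law_prod_right q f g]
    exact Finset.sum_congr rfl fun b _ => h a b
  have hg : ∀ b, law q g b = p b := fun b => by
    rw [← sum_law_prod_left q f g]
    simp [h, ← Finset.mul_sum, (hκ b).2]
  rw [mutualInfo, channelInfo, Fintype.sum_prod_type_right, Finset.sum_mul]
  refine Finset.sum_congr rfl fun a _ => ?_
  rw [Finset.sum_mul]
  refine Finset.sum_congr rfl fun b _ => ?_
  rw [h, hf, hg, Real.logb, mul_assoc, div_mul_cancel₀ _ (Real.log_pos one_lt_two).ne']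
  by_cases hb : p b = 0
  · simp [hb]
  · rw [mul_comm (outPMF p κ a), mul_div_mul_left _ _ hb]

end Information

/-- Nonnegative weights on `A × B` factor through a stochastic kernel. -/
lemma exists_kernel {A B : Type*} [Fintype B] [Nonempty B] {r : A × B → ℝ} (hr : ∀ a, 0 ≤ r a) :
    ∃ κ : A → B → ℝ, (∀ a, κ a ∈ stdSimplex ℝ B) ∧ ∀ a b, r (a, b) = (∑ b, r (a, b)) * κ a b := by
  choose κ h1 h2 using fun a => exists_normalized (a := fun b => r (a, b)) (fun b => hr _)
  exact ⟨κ, h1, h2⟩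

/-! ### From Markov chains to kernels: the direct part. -/

section Direct

variable {W X Y Z : Type*} [Fintype W] [Fintype X] [Fintype Y] [Fintype Z]

/-- The kernels are the conditional laws of `X` given `W`, `Z` given `X` and `Y` given `(Z, W)`,
chosen arbitrarily on null events. Each Markov identity yields one step of the factorization after
cancelling the marginal of its middle variable; where that marginal is zero, both sides vanish. -/
lemma exists_kernels_of_markov [Nonempty X] [Nonempty Y] [Nonempty Z] {q : W × X × Y × Z → ℝ}
    (hq : q ∈ stdSimplex ℝ (W × X × Y × Z))
    (hM₁ : IsMarkovChain q (fun ω => ω.2.2.2) (fun ω => ω.2.1) (fun ω => ω.1))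
    (hM₂ : IsMarkovChain q (fun ω => ω.2.1) (fun ω => (ω.2.2.2, ω.1)) (fun ω => ω.2.2.1)) :
    ∃ (pW : W → ℝ) (κ₁ : W → X → ℝ) (κ₂ : X → Z → ℝ) (κ₃ : Z → W → Y → ℝ),
      pW ∈ stdSimplex ℝ W ∧ (∀ w, κ₁ w ∈ stdSimplex ℝ X) ∧ (∀ x, κ₂ x ∈ stdSimplex ℝ Z) ∧
      (∀ z w, κ₃ z w ∈ stdSimplex ℝ Y) ∧
      ∀ w s, q (w, s) = pW w * tripleChannel κ₁ κ₂ κ₃ w s := by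
  have hq0 := hq.1
  obtain ⟨κ₁, h₁, e₁⟩ := exists_kernel (r := law q (fun ω => (ω.1, ω.2.1)))
    (fun a => law_nonneg hq0 _ a)
  obtain ⟨κ₂, h₂, e₂⟩ := exists_kernel (r := law q (fun ω => (ω.2.1, ω.2.2.2)))
    (fun a => law_nonneg hq0 _ a)
  obtain ⟨κ₃, h₃, e₃⟩ := exists_kernel (r := law q (fun ω => ((ω.2.2.2, ω.1), ω.2.2.1)))
    (fun a => law_nonneg hq0 _ a)
  simp only [fun w => sum_law_prod_right q (fun ω => ω.1) (fun ω => ω.2.1) w] at e₁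
  simp only [fun w => sum_law_prod_right q (fun ω => ω.2.1) (fun ω => ω.2.2.2) w] at e₂
  simp only [fun w => sum_law_prod_right q (fun ω => (ω.2.2.2, ω.1)) (fun ω => ω.2.2.1) w] at e₃
  refine ⟨law q (fun ω => ω.1), κ₁, κ₂, fun z w => κ₃ (z, w),
    ⟨fun w => law_nonneg hq0 _ w, by rw [sum_law]; exact hq.2⟩, h₁, h₂, fun z w => h₃ (z, w), ?_⟩
  have hZXW : ∀ z x w, law q (fun ω => (ω.2.2.2, ω.2.1, ω.1)) (z, x, w) =
      law q (fun ω => ω.1) w * κ₁ w x * κ₂ x z := by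
    intro z x w
    have hm := hM₁ z x w
    rw [law_swap q (fun ω => ω.2.2.2) (fun ω => ω.2.1), law_swap q (fun ω => ω.2.1) (fun ω => ω.1),
      e₂, e₁] at hm
    by_cases hx : law q (fun ω => ω.2.1) x = 0
    · have i1 := law_le_comp hq0 (fun ω => (ω.2.2.2, ω.2.1, ω.1)) (fun a => a.2.1) (z, x, w)
      have i2 := law_le_comp hq0 (fun ω => (ω.1, ω.2.1)) (fun a => a.2) (w, x)
      simp only [hx, e₁] at i1 i2
      have j1 := law_nonneg hq0 (fun ω => (ω.2.2.2, ω.2.1, ω.1)) (z, x, w)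
      have j2 := mul_nonneg (law_nonneg hq0 (fun ω => ω.1) w) ((h₁ w).1 x)
      rw [le_antisymm i1 j1, le_antisymm i2 j2, zero_mul]
    · exact mul_right_cancel₀ hx (by rw [hm]; ring)
  rintro w ⟨x, y, z⟩
  have hm := hM₂ x (z, w) y
  have ea : law q (fun ω => (ω.2.1, (ω.2.2.2, ω.1), ω.2.2.1)) (x, (z, w), y) = q (w, x, y, z) :=
    (law_comp_injective q (fun ω => ω) (g := fun ω => (ω.2.1, (ω.2.2.2, ω.1), ω.2.2.1))
      (fun a b hab => by
        simp only [Prod.mk.injEq] at hab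
        exact Prod.ext hab.2.1.2 (Prod.ext hab.1 (Prod.ext hab.2.2 hab.2.1.1)))
      (w, x, y, z)).trans (law_id q _)
  have eb : law q (fun ω => (ω.2.1, (ω.2.2.2, ω.1))) (x, (z, w)) =
      law q (fun ω => (ω.2.2.2, ω.2.1, ω.1)) (z, x, w) :=
    law_comp_injective q (fun ω => (ω.2.2.2, ω.2.1, ω.1))
      (g := fun a : Z × X × W => (a.2.1, (a.1, a.2.2)))
      (fun a b hab => by
        simp only [Prod.mk.injEq] at hab
        exact Prod.ext hab.2.1 (Prod.ext hab.1 hab.2.2)) (z, x, w)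
  rw [ea, eb, e₃] at hm
  rw [tripleChannel, ← mul_assoc, ← mul_assoc]
  dsimp only
  rw [← hZXW]
  by_cases hzw : law q (fun ω => (ω.2.2.2, ω.1)) (z, w) = 0
  · have i1 := law_le_comp hq0 (fun ω => (ω.2.2.2, ω.2.1, ω.1)) (fun a => (a.1, a.2.2)) (z, x, w)
    have i2 := law_le_comp hq0 (fun ω => ω) (fun a => (a.2.2.2, a.1)) (w, x, y, z)
    rw [law_id] at i2
    simp only [hzw] at i1 i2
    rw [le_antisymm i1 (law_nonneg hq0 _ _), le_antisymm i2 (hq0 _), zero_mul]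
  · exact mul_right_cancel₀ hzw (by rw [hm]; ring)

/-- The direct part, for an arbitrary finite auxiliary alphabet. -/
theorem achievable_of_markov {p : X × Y × Z → ℝ} (hp : p ∈ stdSimplex ℝ (X × Y × Z))
    {R C : ℝ} (hC : 0 ≤ C) {q : W × X × Y × Z → ℝ} (hq : q ∈ stdSimplex ℝ (W × X × Y × Z))
    (hpq : ∀ x y z, p (x, y, z) = ∑ w, q (w, x, y, z))
    (hM₁ : IsMarkovChain q (fun ω => ω.2.2.2) (fun ω => ω.2.1) (fun ω => ω.1))
    (hM₂ : IsMarkovChain q (fun ω => ω.2.1) (fun ω => (ω.2.2.2, ω.1)) (fun ω => ω.2.2.1))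
    (h₁ : mutualInfo q (fun ω => ω.2.1) (fun ω => ω.1)
      - mutualInfo q (fun ω => ω.1) (fun ω => ω.2.2.2) ≤ R)
    (h₂ : mutualInfo q (fun ω => ω.2) (fun ω => ω.1)
      - mutualInfo q (fun ω => ω.1) (fun ω => ω.2.2.2) ≤ R + C) :
    (R, C) ∈ achievableRegion p := by
  have hne : Nonempty (X × Y × Z) := by
    by_contra hcon
    rw [not_nonempty_iff] at hcon
    simpa using hp.2
  obtain ⟨x₀, y₀, z₀⟩ := hne
  have : Nonempty X := ⟨x₀⟩
  have : Nonempty Y := ⟨y₀⟩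
  have : Nonempty Z := ⟨z₀⟩
  obtain ⟨pW, κ₁, κ₂, κ₃, hpW, hκ₁, hκ₂, hκ₃, hfac⟩ := exists_kernels_of_markov hq hM₁ hM₂
  -- Data processing along `Z - X - W`; this ensures that the message set of size about `exp (n *
  -- r)` is nonempty.
  have hR : 0 ≤ R := by
    have := mutualInfo_le_of_markov hq.1 hq.2 hM₁
    linarith
  have hl2 : 0 ≤ Real.log 2 := (Real.log_pos one_lt_two).le
  have lawXW : ∀ x w, law q (fun ω => (ω.2.1, ω.1)) (x, w) = pW w * κ₁ w x := by
    classical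
    intro x w
    simp only [law, Fintype.sum_prod_type, Prod.mk.injEq, hfac, tripleChannel]
    rw [Finset.sum_eq_single w (by simp +contextual) (by simp),
      Finset.sum_eq_single x (by simp +contextual) (by simp)]
    simp only [and_self, if_true]
    rw [Finset.sum_comm]
    simp [← Finset.mul_sum, (hκ₃ _ _).2, (hκ₂ _).2]
  have lawZW : ∀ z w, law q (fun ω => (ω.2.2.2, ω.1)) (z, w) = pW w * cascade κ₁ κ₂ w z := by
    classical
    intro z w
    simp only [law, Fintype.sum_prod_type, Prod.mk.injEq, hfac, tripleChannel, cascade,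
      Finset.mul_sum]
    rw [Finset.sum_eq_single w (by simp +contextual) (by simp)]
    refine Finset.sum_congr rfl fun x _ => ?_
    rw [Finset.sum_comm, Finset.sum_eq_single z (by simp +contextual) (by simp)]
    simp [← Finset.mul_sum, (hκ₃ _ _).2]
  have lawSW : ∀ s w, law q (fun ω => (ω.2, ω.1)) (s, w) = pW w * tripleChannel κ₁ κ₂ κ₃ w s := by
    intro s w
    rw [← hfac, law_swap]
    exact law_id q (w, s)
  have hcas : ∀ w, cascade κ₁ κ₂ w ∈ stdSimplex ℝ Z := fun w =>
    ⟨fun z => Finset.sum_nonneg fun x _ => mul_nonneg ((hκ₁ _).1 _) ((hκ₂ _).1 _),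
      sum_cascade hκ₁ hκ₂ w⟩
  have htri : ∀ w, tripleChannel κ₁ κ₂ κ₃ w ∈ stdSimplex ℝ (X × Y × Z) := fun w =>
    ⟨fun s => mul_nonneg (mul_nonneg ((hκ₁ _).1 _) ((hκ₂ _).1 _)) ((hκ₃ _ _).1 _),
      sum_tripleChannel hκ₁ hκ₂ hκ₃ w⟩
  rw [mutualInfo_comm hq.1 (fun ω => ω.1)] at h₁ h₂
  refine achievable_of_kernels hpW hκ₁ hκ₂ hκ₃ ?_ hR hC ?_ ?_
  · funext ⟨x, y, z⟩
    rw [hpq]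
    exact Finset.sum_congr rfl fun w _ => hfac w _
  · rw [← mutualInfo_eq_channelInfo (q := q) (fun ω => ω.2.1) (fun ω => ω.1) hκ₁ lawXW,
      ← mutualInfo_eq_channelInfo (q := q) (fun ω => ω.2.2.2) (fun ω => ω.1) hcas lawZW, ← sub_mul]
    gcongr
  · rw [← mutualInfo_eq_channelInfo (q := q) (fun ω => ω.2) (fun ω => ω.1) htri lawSW,
      ← mutualInfo_eq_channelInfo (q := q) (fun ω => ω.2.2.2) (fun ω => ω.1) hcas lawZW, ← sub_mul]
    gcongr

end Direct

/-! ### Entropy of unnormalized laws, and continuity of entropy. -/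

section Entropy

variable {Ω A B D : Type*} [Fintype Ω]

lemma law_of_equiv [Fintype B] (q : Ω → ℝ) (f : Ω → A) (e : Ω ≃ A × B)
    (hf : ∀ ω, f ω = (e ω).1) (a : A) : law q f a = ∑ b, q (e.symm (a, b)) := by
  classical
  simp only [law, hf]
  calc ∑ ω, (if (e ω).1 = a then q ω else 0)
      = ∑ b, ∑ ω, (if e ω = (a, b) then q ω else 0) := by
        rw [Finset.sum_comm]
        refine Finset.sum_congr rfl fun ω _ => ?_
        rw [Finset.sum_eq_single (e ω).2 (fun b _ hb => by
          rw [if_neg]; rintro h; rw [h] at hb; exact hb rfl) (by simp)]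
        simp only [Prod.ext_iff, and_true]
    _ = _ := by
        refine Finset.sum_congr rfl fun b _ => ?_
        rw [Finset.sum_eq_single (e.symm (a, b)) (fun ω _ hω => by
          rw [if_neg]; rintro h; exact hω (by rw [← h, e.symm_apply_apply])) (by simp)]
        simp

lemma ent_id [Fintype A] (q : A → ℝ) : ent q (fun a => a) = ∑ a, Real.negMulLog (q a) := by
  simp [ent, law_id]

lemma ent_congr_law [Fintype A] {Ω' : Type*} [Fintype Ω'] {q : Ω → ℝ} {r : Ω' → ℝ} {f : Ω → A}
    {g : Ω' → A} (h : ∀ a, law q f a = law r g a) : ent q f = ent r g := by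
  simp [ent, h]

lemma law_const_mul (t : ℝ) (q : Ω → ℝ) (f : Ω → A) (a : A) :
    law (fun ω => t * q ω) f a = t * law q f a := by
  simp [law, Finset.mul_sum, mul_ite]

lemma law_finset_sum {J : Type*} (s : Finset J) (q : J → Ω → ℝ) (f : Ω → A) (a : A) :
    law (fun ω => ∑ j ∈ s, q j ω) f a = ∑ j ∈ s, law (q j) f a := by
  classical
  simp only [law]
  rw [Finset.sum_comm]
  refine Finset.sum_congr rfl fun ω _ => ?_
  split_ifs <;> simp

/-- The failure of homogeneity depends on the total mass only, not on `f`, so it cancels in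
differences of entropies. -/
lemma ent_const_mul [Fintype A] (t : ℝ) (q : Ω → ℝ) (f : Ω → A) :
    ent (fun ω => t * q ω) f = t * ent q f + Real.negMulLog t * ∑ ω, q ω := by
  simp only [ent, law_const_mul, Real.negMulLog_mul, Finset.sum_add_distrib]
  rw [← Finset.sum_mul, sum_law, ← Finset.mul_sum]
  ring

lemma law_slice [Fintype A] (q : Ω → ℝ) (g : Ω → D) (T : Ω → A) (f : A → B) (d : D) (b : B) :
    law (fun a => law q (fun ω => (g ω, T ω)) (d, a)) f b =
      law q (fun ω => (g ω, f (T ω))) (d, b) := by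
  classical
  simp only [law]
  calc _ = ∑ a, ∑ ω, (if f a = b then (if (g ω, T ω) = (d, a) then q ω else 0) else 0) := by
        refine Finset.sum_congr rfl fun a _ => ?_
        split_ifs <;> simp
    _ = _ := by
        rw [Finset.sum_comm]
        refine Finset.sum_congr rfl fun ω _ => ?_
        rw [Finset.sum_eq_single (T ω) (fun a _ ha => by simp [Prod.ext_iff, ha.symm]) (by simp)]
        by_cases h1 : g ω = d <;> by_cases h2 : f (T ω) = b <;> simp [h1, h2]

/-- With unnormalized slices a joint entropy is an exact sum, without the entropy of `g` as a
separate term. -/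
lemma sum_ent_slice [Fintype A] [Fintype B] [Fintype D] (q : Ω → ℝ) (g : Ω → D) (T : Ω → A)
    (f : A → B) : ∑ d, ent (fun a => law q (fun ω => (g ω, T ω)) (d, a)) f =
      ent q (fun ω => (g ω, f (T ω))) := by
  simp only [ent, law_slice, Fintype.sum_prod_type]

lemma negMulLog_add_le {a b : ℝ} (ha : 0 ≤ a) (hb : 0 ≤ b) :
    Real.negMulLog (a + b) ≤ Real.negMulLog a + Real.negMulLog b := by
  rcases ha.eq_or_lt with rfl | ha
  · simp
  rcases hb.eq_or_lt with rfl | hb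
  · simp
  simp only [Real.negMulLog]
  have h1 := Real.log_le_log ha (by linarith : a ≤ a + b)
  have h2 := Real.log_le_log hb (by linarith : b ≤ a + b)
  nlinarith

/-- The derivative of `x - x log x` is `-log x`, nonnegative up to 1. Adding `x` repairs the lack of
monotonicity of `negMulLog`. -/
lemma negMulLog_add_self_mono {x y : ℝ} (hx : 0 ≤ x) (hxy : x ≤ y) (hy : y ≤ 1) :
    Real.negMulLog x + x ≤ Real.negMulLog y + y := by
  simp only [Real.negMulLog]
  have hl : Real.log y ≤ 0 := Real.log_nonpos (hx.trans hxy) hy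
  rcases hx.eq_or_lt with rfl | hx
  · nlinarith
  have hy0 := hx.trans_le hxy
  have h1 : x * (Real.log y - Real.log x) ≤ y - x := by
    rw [← Real.log_div hy0.ne' hx.ne']
    have := Real.log_le_sub_one_of_pos (div_pos hy0 hx)
    calc x * Real.log (y / x) ≤ x * (y / x - 1) := by gcongr
      _ = y - x := by field_simp
  nlinarith

/-- Comparison with the uniform weight `1 / N`: summed over `N` atoms, the error terms add up to 1.
-/
lemma negMulLog_le_log_card {x N : ℝ} (hx : 0 ≤ x) (hN : 0 < N) :
    Real.negMulLog x ≤ x * Real.log N + 1 / N := by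
  rcases hx.eq_or_lt with rfl | hx
  · simpa using hN.le
  have := Real.log_le_sub_one_of_pos (div_pos one_pos (mul_pos hN hx))
  rw [Real.log_div one_ne_zero (mul_pos hN hx).ne', Real.log_one, Real.log_mul hN.ne' hx.ne'] at this
  have h2 : x * (0 - (Real.log N + Real.log x)) ≤ x * (1 / (N * x)) := by
    gcongr; linarith
  rw [show x * (1 / (N * x)) = 1 / N by field_simp] at h2
  simp only [Real.negMulLog]
  linarith

/-- Continuity of entropy in total variation. -/
lemma entropy_le_of_tvDist [Fintype A] [Nonempty A] {P Q : A → ℝ} (hP : P ∈ stdSimplex ℝ A)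
    (hQ : Q ∈ stdSimplex ℝ A) {ε : ℝ} (h : tvDist Q P ≤ ε) :
    ∑ a, Real.negMulLog (Q a) ≤
      ∑ a, Real.negMulLog (P a) + 1 + ε * (1 + Real.log (Fintype.card A)) := by
  have hN : (0 : ℝ) < Fintype.card A := by exact_mod_cast Fintype.card_pos
  have hlogN : 0 ≤ Real.log (Fintype.card A) :=
    Real.log_nonneg (by exact_mod_cast Nat.succ_le_of_lt Fintype.card_pos)
  have hle1 : ∀ {R : A → ℝ}, R ∈ stdSimplex ℝ A → ∀ a, R a ≤ 1 := fun hR a =>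
    hR.2 ▸ Finset.single_le_sum (fun a _ => hR.1 a) (Finset.mem_univ a)
  have hpt : ∀ a, Real.negMulLog (Q a) ≤ Real.negMulLog (P a) +
      ((|Q a - P a| + (Q a - P a)) / 2 * Real.log (Fintype.card A) + 1 / (Fintype.card A : ℝ)) +
      (|Q a - P a| + (P a - Q a)) / 2 := by
    intro a
    -- The comparison goes from `Q` up to `max P Q` by monotonicity and down to `P` by
    -- subadditivity. The excess of the maximum over either PMF has total mass equal to the total
    -- variation distance.
    have hmax : max (P a) (Q a) = Q a + (|Q a - P a| + (P a - Q a)) / 2 := by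
      rcases le_total (P a) (Q a) with h | h
      · rw [max_eq_right h, abs_of_nonneg (by linarith)]; ring
      · rw [max_eq_left h, abs_of_nonpos (by linarith)]; ring
    have hmax' : max (P a) (Q a) = P a + (|Q a - P a| + (Q a - P a)) / 2 := by
      rw [hmax]; ring
    have h1 := negMulLog_add_self_mono (hQ.1 a) (le_max_right (P a) (Q a))
      (max_le (hle1 hP a) (hle1 hQ a))
    have hd : 0 ≤ (|Q a - P a| + (Q a - P a)) / 2 := by
      have := neg_abs_le (Q a - P a); linarith
    have h2 := negMulLog_add_le (hP.1 a) hd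
    rw [← hmax'] at h2
    have h3 := negMulLog_le_log_card hd hN
    linarith
  refine (Finset.sum_le_sum fun a _ => hpt a).trans ?_
  have hs : ∑ a, (|Q a - P a| + (Q a - P a)) / 2 = tvDist Q P := by
    rw [← Finset.sum_div, Finset.sum_add_distrib, Finset.sum_sub_distrib, hP.2, hQ.2, tvDist]
    ring
  have hs' : ∑ a, (|Q a - P a| + (P a - Q a)) / 2 = tvDist Q P := by
    rw [← Finset.sum_div, Finset.sum_add_distrib, Finset.sum_sub_distrib, hP.2, hQ.2, tvDist]
    ring
  rw [Finset.sum_add_distrib, Finset.sum_add_distrib, Finset.sum_add_distrib, ← Finset.sum_mul,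
    hs, hs', Finset.sum_const, Finset.card_univ, nsmul_eq_mul, mul_one_div_cancel hN.ne']
  nlinarith

lemma entropy_blockPMF [Fintype A] {p : A → ℝ} (hp : p ∈ stdSimplex ℝ A) (n : ℕ) :
    ∑ c, Real.negMulLog (blockPMF n p c) = n * ∑ a, Real.negMulLog (p a) := by
  have h : ∀ c : Fin n → A, Real.negMulLog (blockPMF n p c) =
      (∏ i, p (c i)) * ∑ i, -Real.log (p (c i)) := by
    intro c
    rw [Real.negMulLog, blockPMF]
    by_cases h0 : ∏ i, p (c i) = 0
    · simp [h0]
    · rw [Real.log_prod (fun i hi => Finset.prod_ne_zero_iff.1 h0 i hi)]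
      simp
  simp only [h]
  change iidE p (fun c : Fin n → A => ∑ i, -Real.log (p (c i))) = _
  rw [iidE_sum, Finset.sum_congr rfl fun i _ => iidE_single hp.2 i (fun a => -Real.log (p a))]
  simp [Real.negMulLog]

lemma law_blockPMF [Fintype A] {p : A → ℝ} (hp : p ∈ stdSimplex ℝ A) {n : ℕ} (i : Fin n) (a : A) :
    law (blockPMF n p) (fun c => c i) a = p a := by
  classical
  have := iidE_single hp.2 i (fun b => if b = a then 1 else 0)
  simpa [iidE, law, blockPMF] using this

/-- A uniform independent variable adds the logarithm of the size of its alphabet to the entropy. -/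
lemma sum_negMulLog_uniform [Fintype A] {f : A → ℝ} (hf : ∑ a, f a = 1) {K : ℕ} (hK : 0 < K) :
    ∑ a : A × Fin K, Real.negMulLog ((K : ℝ)⁻¹ * f a.1) =
      Real.log K + ∑ a, Real.negMulLog (f a) := by
  have hK' : (K : ℝ) ≠ 0 := by exact_mod_cast hK.ne'
  rw [Fintype.sum_prod_type]
  simp only [Real.negMulLog_mul, Finset.sum_const, Finset.card_univ, Fintype.card_fin, nsmul_eq_mul,
    mul_add, mul_inv_cancel_left₀ hK', Finset.sum_add_distrib]
  rw [← Finset.mul_sum, ← Finset.sum_mul, hf, Real.negMulLog, Real.log_inv]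
  field_simp

end Entropy

/-! ### Slices, and the entropy bounds satisfied by a code. -/

section Slices

variable {X Y Z : Type*} [Fintype X] [Fintype Y] [Fintype Z]

/-- The unnormalized conditional PMFs of `(X, Y, Z)` given a value of the auxiliary variable that are
compatible with the Markov chains `Z - X - W` and `X - (Z, W) - Y`. -/
structure IsSlice (p u : X × Y × Z → ℝ) : Prop where
  nonneg : ∀ s, 0 ≤ u s
  markov_source : ∀ x z, law u (fun s => (s.1, s.2.2)) (x, z) * law p (fun s => s.1) x =
    law u (fun s => s.1) x * law p (fun s => (s.1, s.2.2)) (x, z)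
  markov_output : IsMarkovChain u (fun s => s.1) (fun s => s.2.2) (fun s => s.2.1)

lemma IsSlice.const_mul {p u : X × Y × Z → ℝ} (h : IsSlice p u) {t : ℝ} (ht : 0 ≤ t) :
    IsSlice p (fun s => t * u s) where
  nonneg s := mul_nonneg ht (h.nonneg s)
  markov_source x z := by
    simp only [law_const_mul]
    rw [mul_assoc, h.markov_source, mul_assoc]
  markov_output x z y := by
    simp only [law_const_mul]
    linear_combination t ^ 2 * h.markov_output x z y

/-- The entropy of `f` minus the entropy of the third coordinate. -/
noncomputable def entDiff {A : Type*} [Fintype A] (u : X × Y × Z → ℝ) (f : X × Y × Z → A) : ℝ :=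
  ent u f - ent u (fun s => s.2.2)

/-- Exact homogeneity, thanks to the cancellation of the mass terms; this is what makes conic
combinations of slices usable. -/
lemma entDiff_const_mul {A : Type*} [Fintype A] (t : ℝ) (u : X × Y × Z → ℝ) (f : X × Y × Z → A) :
    entDiff (fun s => t * u s) f = t * entDiff u f := by
  simp only [entDiff, ent_const_mul]
  ring

/-- The regrouping of a triple with the second coordinate split off. -/
def splitMiddle (X Y Z : Type*) : X × Y × Z ≃ (X × Z) × Y where
  toFun s := ((s.1, s.2.2), s.2.1)
  invFun s := (s.1.1, s.2, s.1.2)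
  left_inv _ := rfl
  right_inv _ := rfl

lemma law_outer (u : X × Y × Z → ℝ) (x : X) (z : Z) :
    law u (fun s => (s.1, s.2.2)) (x, z) = ∑ y, u (x, y, z) :=
  law_of_equiv u _ (splitMiddle X Y Z) (fun _ => rfl) (x, z)

lemma markov_output_of_factor {u : X × Y × Z → ℝ} (a : X → Z → ℝ) (b : Y → Z → ℝ)
    (h : ∀ x y z, u (x, y, z) = a x z * b y z) :
    IsMarkovChain u (fun s => s.1) (fun s => s.2.2) (fun s => s.2.1) := by
  intro x z y
  have e1 : law u (fun s => (s.1, s.2.2, s.2.1)) (x, z, y) = u (x, y, z) :=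
    (law_comp_injective u (fun s => s) (g := fun s : X × Y × Z => (s.1, s.2.2, s.2.1))
      (fun s t hst => by
        simp only [Prod.mk.injEq] at hst
        exact Prod.ext hst.1 (Prod.ext hst.2.2 hst.2.1)) (x, y, z)).trans (law_id _ _)
  have e2 : law u (fun s => (s.2.2, s.2.1)) (z, y) = ∑ x, u (x, y, z) :=
    law_of_equiv u _ (B := X) ⟨fun s => ((s.2.2, s.2.1), s.1), fun s => (s.2, s.1.2, s.1.1),
      fun _ => rfl, fun _ => rfl⟩ (fun _ => rfl) (z, y)
  have e3 : law u (fun s => s.2.2) z = ∑ x, ∑ y, u (x, y, z) := by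
    rw [← Fintype.sum_prod_type']
    exact law_of_equiv u _ (B := X × Y) ⟨fun s => (s.2.2, (s.1, s.2.1)),
      fun s => (s.2.1, s.2.2, s.1), fun _ => rfl, fun _ => rfl⟩ (fun _ => rfl) z
  rw [e1, e2, e3, law_outer]
  simp only [h, ← Finset.mul_sum, ← Finset.sum_mul]
  ring

lemma iidSource_eq_blockPMF (p : X × Y × Z → ℝ) {n : ℕ} (x : Fin n → X) (z : Fin n → Z) :
    iidSource p x z = blockPMF n (law p (fun s => (s.1, s.2.2))) (fun i => (x i, z i)) :=
  Finset.prod_congr rfl fun i _ => (law_outer p (x i) (z i)).symm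

lemma law_mem {Ω A : Type*} [Fintype Ω] [Fintype A] {q : Ω → ℝ} (hq : q ∈ stdSimplex ℝ Ω)
    (f : Ω → A) : law q f ∈ stdSimplex ℝ A :=
  ⟨law_nonneg hq.1 f, by rw [sum_law, hq.2]⟩

variable {n K Θ : ℕ} (c : Code X Y Z n K Θ) (p : X × Y × Z → ℝ)

/-- The joint PMF of the common randomness, the message and the three sequences. -/
noncomputable def Code.joint (ω : Fin K × Fin Θ × (Fin n → X) × (Fin n → Y) × (Fin n → Z)) : ℝ :=
  (K : ℝ)⁻¹ * iidSource p ω.2.2.1 ω.2.2.2.2 * c.enc ω.1 ω.2.2.1 ω.2.1 *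
    c.dec ω.1 ω.2.2.2.2 ω.2.1 ω.2.2.2.1

lemma Code.law_joint_triple (s : (Fin n → X) × (Fin n → Y) × (Fin n → Z)) :
    law (c.joint p) (fun ω => ω.2.2) s = c.inducedPMF p s := by
  refine (law_of_equiv (c.joint p) _ (B := Fin K × Fin Θ) ⟨fun ω => (ω.2.2, (ω.1, ω.2.1)),
    fun a => (a.2.1, a.2.2, a.1), fun _ => rfl, fun _ => rfl⟩ (fun _ => rfl) s).trans ?_
  rw [Fintype.sum_prod_type]
  simp [joint, inducedPMF, Finset.mul_sum, mul_assoc]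

lemma Code.law_joint_source (a : (Fin n → X × Z) × Fin K) :
    law (c.joint p) (fun ω => (fun i => (ω.2.2.1 i, ω.2.2.2.2 i), ω.1)) a =
      (K : ℝ)⁻¹ * blockPMF n (law p (fun s => (s.1, s.2.2))) a.1 := by
  refine (law_of_equiv (c.joint p) _ (B := Fin Θ × (Fin n → Y))
    ⟨fun ω => ((fun i => (ω.2.2.1 i, ω.2.2.2.2 i), ω.1), (ω.2.1, ω.2.2.2.1)),
    fun a => (a.1.2, a.2.1, fun i => (a.1.1 i).1, a.2.2, fun i => (a.1.1 i).2),
    fun _ => rfl, fun _ => rfl⟩ (fun _ => rfl) a).trans ?_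
  rw [Fintype.sum_prod_type]
  simp [joint, ← Finset.mul_sum, (c.dec_mem _ _ _).2, (c.enc_mem _ _).2, iidSource_eq_blockPMF]

lemma Code.law_joint_side (a : (Fin n → Z) × Fin K) :
    law (c.joint p) (fun ω => (ω.2.2.2.2, ω.1)) a =
      (K : ℝ)⁻¹ * blockPMF n (law p (fun s => s.2.2)) a.1 := by
  refine (law_of_equiv (c.joint p) _ (B := (Fin n → X) × Fin Θ × (Fin n → Y))
    ⟨fun ω => ((ω.2.2.2.2, ω.1), (ω.2.2.1, ω.2.1, ω.2.2.2.1)),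
    fun a => (a.1.2, a.2.2.1, a.2.1, a.2.2.2, a.1.1),
    fun _ => rfl, fun _ => rfl⟩ (fun _ => rfl) a).trans ?_
  rw [Fintype.sum_prod_type]
  simp only [Fintype.sum_prod_type, joint, Equiv.coe_fn_symm_mk, ← Finset.mul_sum,
    (c.dec_mem _ _ _).2, (c.enc_mem _ _).2, mul_one, iidSource_eq_blockPMF, blockPMF]
  congr 1
  have h := Finset.prod_univ_sum (fun _ : Fin n => (Finset.univ : Finset X))
    (fun i x => law p (fun s => (s.1, s.2.2)) (x, a.1 i))
  rw [Fintype.piFinset_univ] at h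
  rw [← h]
  exact Finset.prod_congr rfl fun i _ => sum_law_prod_left p (fun s => s.1) (fun s => s.2.2) _

variable {p}

lemma Code.joint_mem (hp : p ∈ stdSimplex ℝ (X × Y × Z)) (hK : 0 < K) :
    c.joint p ∈ stdSimplex ℝ (Fin K × Fin Θ × (Fin n → X) × (Fin n → Y) × (Fin n → Z)) := by
  have hK' : (K : ℝ) ≠ 0 := by exact_mod_cast hK.ne'
  refine ⟨fun ω => mul_nonneg (mul_nonneg (mul_nonneg (by positivity)
    (Finset.prod_nonneg fun i _ => Finset.sum_nonneg fun y _ => hp.1 _)) ((c.enc_mem _ _).1 _))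
    ((c.dec_mem _ _ _).1 _), ?_⟩
  rw [← sum_law _ (fun ω => (ω.2.2.2.2, ω.1)), Finset.sum_congr rfl fun a _ => c.law_joint_side p a,
    Fintype.sum_prod_type]
  simp [← Finset.mul_sum, (blockPMF_mem (law_mem hp _)).2, mul_inv_cancel₀ hK']

lemma Code.law_joint_source_single (hp : p ∈ stdSimplex ℝ (X × Y × Z)) (hK : 0 < K)
    (i : Fin n) (a : X × Z) :
    law (c.joint p) (fun ω => (ω.2.2.1 i, ω.2.2.2.2 i)) a = law p (fun s => (s.1, s.2.2)) a := by
  have hK' : (K : ℝ) ≠ 0 := by exact_mod_cast hK.ne'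
  rw [law_comp (c.joint p) (fun ω i => (ω.2.2.1 i, ω.2.2.2.2 i)) (fun c => c i),
    ← law_blockPMF (law_mem hp _) i]
  congr 1
  funext b
  rw [← sum_law_prod_right _ _ (fun ω => ω.1), Finset.sum_congr rfl fun μ _ =>
    c.law_joint_source p (b, μ)]
  simp [mul_inv_cancel_left₀ hK']

/-- The rate bound for the message. -/
lemma Code.log_card_message_ge (hp : p ∈ stdSimplex ℝ (X × Y × Z)) (hK : 0 < K) :
    n * ent p (fun s => (s.1, s.2.2)) - n * ent p (fun s => s.2.2) ≤ Real.log Θ +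
      ∑ i, (ent (c.joint p) (fun ω => (ω.2.2.1 i, ((ω.2.2.2.2, ω.1), ω.2.1))) -
        ent (c.joint p) (fun ω => ((ω.2.2.2.2, ω.1), ω.2.1))) := by
  have hq := c.joint_mem hp hK
  have e1 : ent (c.joint p) (fun ω => (fun i => (ω.2.2.1 i, ω.2.2.2.2 i), ω.1)) =
      Real.log K + n * ent p (fun s => (s.1, s.2.2)) := by
    rw [ent, Finset.sum_congr rfl fun a _ => by rw [c.law_joint_source p a],
      sum_negMulLog_uniform (blockPMF_mem (law_mem hp _)).2 hK, entropy_blockPMF (law_mem hp _)]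
    rfl
  have e2 : ent (c.joint p) (fun ω => (ω.2.2.2.2, ω.1)) =
      Real.log K + n * ent p (fun s => s.2.2) := by
    rw [ent, Finset.sum_congr rfl fun a _ => by rw [c.law_joint_side p a],
      sum_negMulLog_uniform (blockPMF_mem (law_mem hp _)).2 hK, entropy_blockPMF (law_mem hp _)]
    rfl
  have e3 : ent (c.joint p) (fun ω => (fun i => (ω.2.2.1 i, ω.2.2.2.2 i), ω.1)) =
      ent (c.joint p) (fun ω => (ω.2.2.1, (ω.2.2.2.2, ω.1))) :=
    ent_comp_injective (c.joint p) (fun ω => (ω.2.2.1, (ω.2.2.2.2, ω.1)))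
      (g := fun a => (fun i => (a.1 i, a.2.1 i), a.2.2)) (fun a b hab => by
        simp only [Prod.mk.injEq, funext_iff] at hab
        exact Prod.ext (funext fun i => (hab.1 i).1)
          (Prod.ext (funext fun i => (hab.1 i).2) hab.2))
  have e4 : ent (c.joint p) (fun ω => ((ω.2.2.1, (ω.2.2.2.2, ω.1)), ω.2.1)) =
      ent (c.joint p) (fun ω => (ω.2.2.1, ((ω.2.2.2.2, ω.1), ω.2.1))) :=
    ent_comp_injective (c.joint p) (fun ω => (ω.2.2.1, ((ω.2.2.2.2, ω.1), ω.2.1)))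
      (g := (Equiv.prodAssoc _ _ _).symm) (Equiv.injective _)
  -- Adjoin the message on the left, remove it at a cost of `log Θ` on the right, and split `X^n`
  -- into letters. The common randomness appears on both sides and its `log K` cancels.
  have i1 := ent_le_prod_left hq.1 (fun ω => (ω.2.2.1, (ω.2.2.2.2, ω.1))) (fun ω => ω.2.1)
  have i2 := ent_prod_le_add_log_card hq.1 hq.2 (fun ω => (ω.2.2.2.2, ω.1)) (fun ω => ω.2.1)
  have i3 := ent_pi_le hq.1 hq.2 (fun ω => ω.2.2.1) (fun ω => ((ω.2.2.2.2, ω.1), ω.2.1))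
  rw [Fintype.card_fin] at i2
  linarith

/-- The rate bound for the message and the common randomness. -/
lemma Code.log_card_total_ge (hp : p ∈ stdSimplex ℝ (X × Y × Z)) (hK : 0 < K) :
    ∑ s, Real.negMulLog (c.inducedPMF p s) - n * ent p (fun s => s.2.2) ≤
      Real.log K + Real.log Θ +
      ∑ i, (ent (c.joint p) (fun ω => ((ω.2.2.1 i, ω.2.2.2.1 i), ((ω.2.2.2.2, ω.1), ω.2.1))) -
        ent (c.joint p) (fun ω => ((ω.2.2.2.2, ω.1), ω.2.1))) := by
  have hq := c.joint_mem hp hK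
  have e1 : ent (c.joint p) (fun ω => ω.2.2) = ∑ s, Real.negMulLog (c.inducedPMF p s) := by
    rw [ent, Finset.sum_congr rfl fun a _ => by rw [c.law_joint_triple p a]]
  have e2 : ent (c.joint p) (fun ω => (ω.2.2.2.2, ω.1)) =
      Real.log K + n * ent p (fun s => s.2.2) := by
    rw [ent, Finset.sum_congr rfl fun a _ => by rw [c.law_joint_side p a],
      sum_negMulLog_uniform (blockPMF_mem (law_mem hp _)).2 hK, entropy_blockPMF (law_mem hp _)]
    rfl
  have e3 : ent (c.joint p) (fun ω => (ω.2.2, (ω.1, ω.2.1))) = ent (c.joint p) (fun ω =>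
      ((fun i => (ω.2.2.1 i, ω.2.2.2.1 i)), ((ω.2.2.2.2, ω.1), ω.2.1))) :=
    ent_comp_injective (c.joint p) (fun ω =>
      ((fun i => (ω.2.2.1 i, ω.2.2.2.1 i)), ((ω.2.2.2.2, ω.1), ω.2.1)))
      (g := fun a => ((fun i => (a.1 i).1, fun i => (a.1 i).2, a.2.1.1), (a.2.1.2, a.2.2)))
      (fun a b hab => by
        simp only [Prod.mk.injEq, funext_iff] at hab
        exact Prod.ext (funext fun i => Prod.ext (hab.1.1 i) (hab.1.2.1 i))
          (Prod.ext (Prod.ext (funext hab.1.2.2) hab.2.1) hab.2.2))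
  -- Now the common randomness is absent on the left: the output is close to the target only after
  -- averaging over it. Hence `log K` survives and the bound is on the sum of the rates.
  have i1 := ent_le_prod_left hq.1 (fun ω => ω.2.2) (fun ω => (ω.1, ω.2.1))
  have i2 := ent_prod_le_add_log_card hq.1 hq.2 (fun ω => (ω.2.2.2.2, ω.1)) (fun ω => ω.2.1)
  have i3 := ent_pi_le hq.1 hq.2 (fun ω => fun i => (ω.2.2.1 i, ω.2.2.2.1 i))
    (fun ω => ((ω.2.2.2.2, ω.1), ω.2.1))
  rw [Fintype.card_fin] at i2
  linarith

end Slices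

/-! ### Single-letterization of a code. -/

section SingleLetter

variable {X Y Z : Type*} [Fintype Y]

lemma iidSource_split {n : ℕ} (p : X × Y × Z → ℝ) (i : Fin n) (x : X) (z : Z) (x' : {j // j ≠ i} → X)
    (v : {j // j ≠ i} → Z) :
    iidSource p ((Equiv.funSplitAt i X).symm (x, x')) ((Equiv.funSplitAt i Z).symm (z, v)) =
      (∑ y, p (x, y, z)) * ∏ j, ∑ y, p (x' j, y, v j) := by
  rw [iidSource, Fintype.prod_eq_mul_prod_subtype_ne _ i]
  congr 1
  · simp
  · refine Finset.prod_congr rfl fun j _ => ?_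
    simp [j.2]

variable [Fintype X] [Fintype Z] {n K Θ : ℕ} (c : Code X Y Z n K Θ) (p : X × Y × Z → ℝ)

/-- The auxiliary variable of letter `i`: the common randomness, the message and the other letters
of the side information. -/
def auxVar (i : Fin n) (ω : Fin K × Fin Θ × (Fin n → X) × (Fin n → Y) × (Fin n → Z)) :
    Fin K × Fin Θ × ({j // j ≠ i} → Z) :=
  (ω.1, ω.2.1, fun j => ω.2.2.2.2 j)

/-- The letter `i` of the three sequences. -/
def letter (i : Fin n) (s : (Fin n → X) × (Fin n → Y) × (Fin n → Z)) : X × Y × Z :=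
  (s.1 i, s.2.1 i, s.2.2 i)

/-- The joint PMF of letter `i` with a value of its auxiliary variable. -/
noncomputable def Code.letterSlice (i : Fin n) (w : Fin K × Fin Θ × ({j // j ≠ i} → Z))
    (s : X × Y × Z) : ℝ :=
  law (c.joint p) (fun ω => (auxVar i ω, letter i ω.2.2)) (w, s)

/-- Splitting off letter `i` and the auxiliary variable from an outcome. -/
def splitLetter (n K Θ : ℕ) (X Y Z : Type*) (i : Fin n) :
    Fin K × Fin Θ × (Fin n → X) × (Fin n → Y) × (Fin n → Z) ≃
      ((Fin K × Fin Θ × ({j // j ≠ i} → Z)) × (X × Y × Z)) ×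
        (({j // j ≠ i} → X) × ({j // j ≠ i} → Y)) where
  toFun ω := ((auxVar i ω, letter i ω.2.2), (fun j => ω.2.2.1 j, fun j => ω.2.2.2.1 j))
  invFun a := (a.1.1.1, a.1.1.2.1, (Equiv.funSplitAt i X).symm (a.1.2.1, a.2.1),
    (Equiv.funSplitAt i Y).symm (a.1.2.2.1, a.2.2),
    (Equiv.funSplitAt i Z).symm (a.1.2.2.2, a.1.1.2.2))
  left_inv ω := by
    obtain ⟨μ, m, x, y, z⟩ := ω
    exact congrArg (fun a => (μ, m, a)) (Prod.ext ((Equiv.funSplitAt i X).symm_apply_apply x)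
      (Prod.ext ((Equiv.funSplitAt i Y).symm_apply_apply y)
        ((Equiv.funSplitAt i Z).symm_apply_apply z)))
  right_inv a := by
    obtain ⟨⟨⟨μ, m, v⟩, x, y, z⟩, x', y'⟩ := a
    have hx := (Equiv.funSplitAt i X).apply_symm_apply (x, x')
    have hy := (Equiv.funSplitAt i Y).apply_symm_apply (y, y')
    have hz := (Equiv.funSplitAt i Z).apply_symm_apply (z, v)
    have hx1 := congrArg Prod.fst hx
    have hx2 := congrArg Prod.snd hx
    have hy1 := congrArg Prod.fst hy
    have hy2 := congrArg Prod.snd hy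
    have hz1 := congrArg Prod.fst hz
    have hz2 := congrArg Prod.snd hz
    exact Prod.ext (Prod.ext (Prod.ext rfl (Prod.ext rfl hz2)) (Prod.ext hx1 (Prod.ext hy1 hz1)))
      (Prod.ext hx2 hy2)

/-- The auxiliary variable fixes the side information at the other letters, so the decoder sees only
`z` besides, and the remaining source letters are summed against the encoder alone. The result is
the `(X, Z)`-marginal times a function of `x` times a function of `(y, z)`, from which both Markov
conditions are read off. -/
lemma Code.letterSlice_eq (i : Fin n) (μ : Fin K) (m : Fin Θ) (v : {j // j ≠ i} → Z) (x : X)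
    (y : Y) (z : Z) : c.letterSlice p i (μ, m, v) (x, y, z) =
      (law p (fun s => (s.1, s.2.2)) (x, z) * ((K : ℝ)⁻¹ *
        ∑ x' : {j // j ≠ i} → X, (∏ j, ∑ y, p (x' j, y, v j)) *
          c.enc μ ((Equiv.funSplitAt i X).symm (x, x')) m)) *
      ∑ y' : {j // j ≠ i} → Y, c.dec μ ((Equiv.funSplitAt i Z).symm (z, v)) m
        ((Equiv.funSplitAt i Y).symm (y, y')) := by
  refine (law_of_equiv (c.joint p) _ (splitLetter n K Θ X Y Z i) (fun _ => rfl) _).trans ?_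
  rw [Fintype.sum_prod_type, Finset.mul_sum (s := (Finset.univ : Finset ({j // j ≠ i} → X))),
    Finset.mul_sum (s := (Finset.univ : Finset ({j // j ≠ i} → X))), Finset.sum_mul_sum]
  refine Finset.sum_congr rfl fun x' _ => Finset.sum_congr rfl fun y' _ => ?_
  simp only [joint, splitLetter, Equiv.coe_fn_symm_mk, iidSource_split, law_outer]
  ring

lemma sum_split {A : Type*} [Fintype A] (i : Fin n) (f : (Fin n → A) → ℝ) :
    ∑ a, ∑ a' : {j // j ≠ i} → A, f ((Equiv.funSplitAt i A).symm (a, a')) = ∑ a, f a := by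
  rw [← Fintype.sum_prod_type']
  exact (Equiv.funSplitAt i A).symm.sum_comp f

variable {p}

lemma Code.isSlice_letterSlice (hp : p ∈ stdSimplex ℝ (X × Y × Z)) (hK : 0 < K) (i : Fin n)
    (w : Fin K × Fin Θ × ({j // j ≠ i} → Z)) : IsSlice p (c.letterSlice p i w) := by
  obtain ⟨μ, m, v⟩ := w
  have hout : ∀ x z, law (c.letterSlice p i (μ, m, v)) (fun s => (s.1, s.2.2)) (x, z) =
      law p (fun s => (s.1, s.2.2)) (x, z) * ((K : ℝ)⁻¹ *
        ∑ x' : {j // j ≠ i} → X, (∏ j, ∑ y, p (x' j, y, v j)) *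
          c.enc μ ((Equiv.funSplitAt i X).symm (x, x')) m) := by
    intro x z
    rw [law_outer]
    simp only [c.letterSlice_eq]
    rw [← Finset.mul_sum, sum_split i (fun y => c.dec μ _ m y), (c.dec_mem _ _ _).2, mul_one]
  refine ⟨fun s => law_nonneg (c.joint_mem hp hK).1 _ _, fun x z => ?_,
    markov_output_of_factor _ _ (fun x y z => c.letterSlice_eq p i μ m v x y z)⟩
  rw [hout, ← sum_law_prod_right _ (fun s : X × Y × Z => s.1) (fun s => s.2.2),
    ← sum_law_prod_right (c.letterSlice p i (μ, m, v)) (fun s : X × Y × Z => s.1) (fun s => s.2.2)]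
  simp only [hout, ← Finset.sum_mul]
  ring

lemma Code.sum_letterSlice (i : Fin n) (s : X × Y × Z) :
    ∑ w, c.letterSlice p i w s = law (c.inducedPMF p) (letter i) s := by
  refine (sum_law_prod_left _ _ _ _).trans ?_
  rw [law_comp (c.joint p) (fun ω => ω.2.2) (letter i)]
  congr 1
  funext s
  exact c.law_joint_triple p s

/-- Both single-letter conditional entropies in terms of the slices. -/
lemma Code.sum_entDiff_letterSlice (hp : p ∈ stdSimplex ℝ (X × Y × Z)) (hK : 0 < K) (i : Fin n) :
    ent (c.joint p) (fun ω => (ω.2.2.1 i, ((ω.2.2.2.2, ω.1), ω.2.1))) -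
        ent (c.joint p) (fun ω => ((ω.2.2.2.2, ω.1), ω.2.1)) =
      ent p (fun s => (s.1, s.2.2)) - ent p (fun s => s.1) +
        ∑ w, entDiff (c.letterSlice p i w) (fun s => s.1) ∧
    ent (c.joint p) (fun ω => ((ω.2.2.1 i, ω.2.2.2.1 i), ((ω.2.2.2.2, ω.1), ω.2.1))) -
        ent (c.joint p) (fun ω => ((ω.2.2.2.2, ω.1), ω.2.1)) =
      ∑ w, entDiff (c.letterSlice p i w) (fun s => s) := by
  have hq := c.joint_mem hp hK
  have hsymm : ∀ z : Fin n → Z,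
      (Equiv.funSplitAt i Z).symm (z i, fun j : {j // j ≠ i} => z j) = z := fun z =>
    (Equiv.funSplitAt i Z).symm_apply_apply z
  have s1 : ent (c.joint p) (fun ω => ((ω.2.2.2.2, ω.1), ω.2.1)) =
      ent (c.joint p) (fun ω => (auxVar i ω, ω.2.2.2.2 i)) := by
    rw [← ent_comp_injective (c.joint p) (fun ω => (auxVar i ω, ω.2.2.2.2 i))
      (g := fun a => (((Equiv.funSplitAt i Z).symm (a.2, a.1.2.2), a.1.1), a.1.2.1))
      (fun a b hab => by
        simp only [Prod.mk.injEq, EmbeddingLike.apply_eq_iff_eq] at hab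
        exact Prod.ext (Prod.ext hab.1.2 (Prod.ext hab.2 hab.1.1.2)) hab.1.1.1)]
    simp only [auxVar, hsymm]
  have s2 : ent (c.joint p) (fun ω => (ω.2.2.1 i, ((ω.2.2.2.2, ω.1), ω.2.1))) =
      ent (c.joint p) (fun ω => (ω.2.2.2.2 i, ω.2.2.1 i, auxVar i ω)) := by
    rw [← ent_comp_injective (c.joint p) (fun ω => (ω.2.2.2.2 i, ω.2.2.1 i, auxVar i ω))
      (g := fun a => (a.2.1, (((Equiv.funSplitAt i Z).symm (a.1, a.2.2.2.2), a.2.2.1), a.2.2.2.1)))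
      (fun a b hab => by
        simp only [Prod.mk.injEq, EmbeddingLike.apply_eq_iff_eq] at hab
        exact Prod.ext hab.2.1.1.1 (Prod.ext hab.1
          (Prod.ext hab.2.1.2 (Prod.ext hab.2.2 hab.2.1.1.2))))]
    simp only [auxVar, hsymm]
  have s3 : ent (c.joint p) (fun ω => ((ω.2.2.1 i, ω.2.2.2.1 i), ((ω.2.2.2.2, ω.1), ω.2.1))) =
      ent (c.joint p) (fun ω => (auxVar i ω, letter i ω.2.2)) := by
    rw [← ent_comp_injective (c.joint p) (fun ω => (auxVar i ω, letter i ω.2.2))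
      (g := fun a => ((a.2.1, a.2.2.1),
        (((Equiv.funSplitAt i Z).symm (a.2.2.2, a.1.2.2), a.1.1), a.1.2.1)))
      (fun a b hab => by
        simp only [Prod.mk.injEq, EmbeddingLike.apply_eq_iff_eq] at hab
        exact Prod.ext (Prod.ext hab.2.1.2 (Prod.ext hab.2.2 hab.2.1.1.2))
          (Prod.ext hab.1.1 (Prod.ext hab.1.2 hab.2.1.1.1)))]
    simp only [auxVar, letter, hsymm]
  have t1 : ∑ w, ent (c.letterSlice p i w) (fun s => s.1) =
      ent (c.joint p) (fun ω => (auxVar i ω, ω.2.2.1 i)) :=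
    sum_ent_slice (c.joint p) (auxVar i) (fun ω => letter i ω.2.2) (fun s => s.1)
  have t2 : ∑ w, ent (c.letterSlice p i w) (fun s => s.2.2) =
      ent (c.joint p) (fun ω => (auxVar i ω, ω.2.2.2.2 i)) :=
    sum_ent_slice (c.joint p) (auxVar i) (fun ω => letter i ω.2.2) (fun s => s.2.2)
  have t3 : ∑ w, ent (c.letterSlice p i w) (fun s => s) =
      ent (c.joint p) (fun ω => (auxVar i ω, letter i ω.2.2)) :=
    sum_ent_slice (c.joint p) (auxVar i) (fun ω => letter i ω.2.2) (fun s => s)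
  have lXZ := c.law_joint_source_single hp hK i
  have lX : ∀ x, law (c.joint p) (fun ω => ω.2.2.1 i) x = law p (fun s => s.1) x := by
    intro x
    rw [← sum_law_prod_right (c.joint p) (fun ω => ω.2.2.1 i) (fun ω => ω.2.2.2.2 i),
      ← sum_law_prod_right p (fun s => s.1) (fun s => s.2.2)]
    exact Finset.sum_congr rfl fun z _ => lXZ (x, z)
  have hM : IsMarkovChain (c.joint p) (fun ω => ω.2.2.2.2 i) (fun ω => ω.2.2.1 i) (auxVar i) := by
    intro z x w
    have h := (c.isSlice_letterSlice hp hK i w).markov_source x z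
    have e1 : law (c.letterSlice p i w) (fun s => (s.1, s.2.2)) (x, z) =
        law (c.joint p) (fun ω => (auxVar i ω, (ω.2.2.1 i, ω.2.2.2.2 i))) (w, (x, z)) :=
      law_slice (c.joint p) (auxVar i) (fun ω => letter i ω.2.2) (fun s => (s.1, s.2.2)) w (x, z)
    have e2 : law (c.letterSlice p i w) (fun s => s.1) x =
        law (c.joint p) (fun ω => (auxVar i ω, ω.2.2.1 i)) (w, x) :=
      law_slice (c.joint p) (auxVar i) (fun ω => letter i ω.2.2) (fun s => s.1) w x
    have e3 : law (c.joint p) (fun ω => (ω.2.2.2.2 i, ω.2.2.1 i, auxVar i ω)) (z, x, w) =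
        law (c.joint p) (fun ω => (auxVar i ω, (ω.2.2.1 i, ω.2.2.2.2 i))) (w, (x, z)) :=
      law_comp_injective (c.joint p) (fun ω => (auxVar i ω, (ω.2.2.1 i, ω.2.2.2.2 i)))
        (g := fun a => (a.2.2, a.2.1, a.1)) (fun a b hab => by
          simp only [Prod.mk.injEq] at hab
          exact Prod.ext hab.2.2 (Prod.ext hab.2.1 hab.1)) (w, (x, z))
    rw [e1, e2, ← lX, ← lXZ] at h
    have e4 := law_swap (c.joint p) (fun ω => ω.2.2.2.2 i) (fun ω => ω.2.2.1 i) z x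
    have e5 := law_swap (c.joint p) (fun ω => ω.2.2.1 i) (auxVar i) x w
    rw [e3, h, e4, e5]
    ring
  -- The chain `Z_i - X_i - W_i` removes the joint entropy of all three variables. The laws of `X_i`
  -- and `(X_i, Z_i)` are exactly those of `p`, because a code does not alter the source.
  have hm := ent_markov hq.1 hM
  have r1 := ent_swap (c.joint p) (fun ω => ω.2.2.2.2 i) (fun ω => ω.2.2.1 i)
  have r2 := ent_swap (c.joint p) (fun ω => ω.2.2.1 i) (auxVar i)
  rw [ent_congr_law lX, r1, ent_congr_law lXZ, r2] at hm
  simp only [entDiff, Finset.sum_sub_distrib, t1, t2, t3, s1, s2, s3]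
  exact ⟨by linarith, trivial⟩

lemma law_iidPMF_letter (hp : p ∈ stdSimplex ℝ (X × Y × Z)) (i : Fin n) (s : X × Y × Z) :
    law (iidPMF p n) (letter i) s = p s := by
  classical
  rw [← law_blockPMF hp i s, law, law, ← (tripleEquiv n X Y Z).sum_comp]
  rfl

lemma sum_negMulLog_iidPMF (hp : p ∈ stdSimplex ℝ (X × Y × Z)) (n : ℕ) :
    ∑ s, Real.negMulLog (iidPMF p n s) = n * ent p (fun s => s) := by
  rw [ent_id, ← entropy_blockPMF hp, ← (tripleEquiv n X Y Z).sum_comp]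
  rfl

lemma iidPMF_mem (hp : p ∈ stdSimplex ℝ (X × Y × Z)) (n : ℕ) :
    iidPMF p n ∈ stdSimplex ℝ ((Fin n → X) × (Fin n → Y) × (Fin n → Z)) := by
  refine ⟨fun s => Finset.prod_nonneg fun i _ => hp.1 _, ?_⟩
  rw [← (blockPMF_mem (n := n) hp).2, ← (tripleEquiv n X Y Z).sum_comp]
  rfl

lemma Code.inducedPMF_mem (hp : p ∈ stdSimplex ℝ (X × Y × Z)) (hK : 0 < K) :
    c.inducedPMF p ∈ stdSimplex ℝ ((Fin n → X) × (Fin n → Y) × (Fin n → Z)) := by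
  rw [← funext (c.law_joint_triple p)]
  exact law_mem (c.joint_mem hp hK) _

/-- The single-letter form of the converse, with an auxiliary alphabet that depends on the code. -/
theorem Code.exists_slices (hp : p ∈ stdSimplex ℝ (X × Y × Z)) (hK : 0 < K) (hn : 0 < n) :
    ∃ u : (Σ i : Fin n, Fin K × Fin Θ × ({j // j ≠ i} → Z)) → X × Y × Z → ℝ,
      (∀ j, IsSlice p (u j)) ∧
      ∑ s, |∑ j, u j s - p s| ≤ 2 * tvDist (iidPMF p n) (c.inducedPMF p) ∧
      n * (ent p (fun s => s.1) - ent p (fun s => s.2.2) -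
        ∑ j, entDiff (u j) (fun s => s.1)) ≤ Real.log Θ ∧
      ∑ s, Real.negMulLog (c.inducedPMF p s) - n * (ent p (fun s => s.2.2) +
        ∑ j, entDiff (u j) (fun s => s)) ≤ Real.log K + Real.log Θ := by
  have hn' : (0 : ℝ) < n := by exact_mod_cast hn
  -- Time sharing: a uniform letter index becomes part of the auxiliary variable, which is why the
  -- index type is a sigma type.
  refine ⟨fun j s => (n : ℝ)⁻¹ * c.letterSlice p j.1 j.2 s,
    fun j => (c.isSlice_letterSlice hp hK j.1 j.2).const_mul (by positivity), ?_, ?_, ?_⟩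
  · have hpt : ∀ s, |∑ j : (Σ i : Fin n, Fin K × Fin Θ × ({j // j ≠ i} → Z)),
        (n : ℝ)⁻¹ * c.letterSlice p j.1 j.2 s - p s| ≤
        ∑ i : Fin n, (n : ℝ)⁻¹ * |law (c.inducedPMF p) (letter i) s -
          law (iidPMF p n) (letter i) s| := by
      intro s
      have : ∑ j : (Σ i : Fin n, Fin K × Fin Θ × ({j // j ≠ i} → Z)),
          (n : ℝ)⁻¹ * c.letterSlice p j.1 j.2 s - p s =
          ∑ i : Fin n, (n : ℝ)⁻¹ * (law (c.inducedPMF p) (letter i) s -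
          law (iidPMF p n) (letter i) s) := by
        rw [Fintype.sum_sigma]
        simp only [← Finset.mul_sum, c.sum_letterSlice, law_iidPMF_letter hp,
          Finset.sum_sub_distrib, mul_sub, Finset.sum_const, Finset.card_univ, Fintype.card_fin,
          nsmul_eq_mul, inv_mul_cancel_left₀ hn'.ne']
      rw [this]
      refine (Finset.abs_sum_le_sum_abs _ _).trans (le_of_eq ?_)
      simp [abs_mul]
    calc _ ≤ ∑ s, ∑ i : Fin n, (n : ℝ)⁻¹ * |law (c.inducedPMF p) (letter i) s -
          law (iidPMF p n) (letter i) s| := Finset.sum_le_sum fun s _ => hpt s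
      _ = ∑ i : Fin n, (n : ℝ)⁻¹ * ∑ s, |law (c.inducedPMF p) (letter i) s -
          law (iidPMF p n) (letter i) s| := by
          rw [Finset.sum_comm]; simp only [Finset.mul_sum]
      _ ≤ ∑ i : Fin n, (n : ℝ)⁻¹ * ∑ s, |c.inducedPMF p s - iidPMF p n s| := by
          gcongr
          exact sum_abs_law_sub_le _ _ _
      _ = _ := by
          simp only [Finset.sum_const, Finset.card_univ, Fintype.card_fin, nsmul_eq_mul,
            mul_inv_cancel_left₀ hn'.ne', tvDist, abs_sub_comm (c.inducedPMF p _)]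
          ring
  · have h := c.log_card_message_ge hp hK
    rw [Finset.sum_congr rfl fun i _ => (c.sum_entDiff_letterSlice hp hK i).1,
      Finset.sum_add_distrib, Finset.sum_const, Finset.card_univ, Fintype.card_fin,
      nsmul_eq_mul] at h
    rw [Fintype.sum_sigma]
    simp only [entDiff_const_mul, ← Finset.mul_sum, mul_sub, mul_inv_cancel_left₀ hn'.ne']
    linarith
  · have h := c.log_card_total_ge hp hK
    rw [Finset.sum_congr rfl fun i _ => (c.sum_entDiff_letterSlice hp hK i).2] at h
    rw [Fintype.sum_sigma]
    simp only [entDiff_const_mul, ← Finset.mul_sum, mul_add, mul_inv_cancel_left₀ hn'.ne']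
    linarith

end SingleLetter

/-! ### Cardinality bound, and the converse up to an error. -/

/-- Carathéodory's theorem for cones: a sum of vectors is a nonnegative combination of at most
`finrank` many of them. -/
lemma exists_conic_combination {J E : Type*} [Fintype J] [AddCommGroup E] [Module ℝ E]
    [FiniteDimensional ℝ E] (v : J → E) :
    ∃ c : J → ℝ, (∀ j, 0 ≤ c j) ∧ ∑ j, c j • v j = ∑ j, v j ∧
      Fintype.card {j // c j ≠ 0} ≤ Module.finrank ℝ E := by
  classical
  let A : Set (J → ℝ) := {c | (∀ j, 0 ≤ c j) ∧ ∑ j, c j • v j = ∑ j, v j}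
  have hA : A.Nonempty := ⟨fun _ => 1, fun _ => zero_le_one, by simp⟩
  -- A coefficient family of minimal support is supported on independent vectors, since a linear
  -- relation would allow another coefficient to be eliminated.
  obtain ⟨c, hc, hmin⟩ := exists_minimalFor_of_wellFoundedLT (· ∈ A)
    (fun c => (Finset.univ.filter fun j => c j ≠ 0).card) hA
  refine ⟨c, hc.1, hc.2, ?_⟩
  have hli : LinearIndependent ℝ (fun j : {j // c j ≠ 0} => v j) := by
    by_contra hcon
    rw [Fintype.not_linearIndependent_iff] at hcon
    obtain ⟨g₀, hg₀, j₀, hj₀⟩ := hcon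
    obtain ⟨g, hg, j₁, hj₁⟩ : ∃ g : {j // c j ≠ 0} → ℝ, ∑ j, g j • v j = 0 ∧ ∃ j, 0 < g j := by
      rcases lt_or_gt_of_ne hj₀ with h | h
      · exact ⟨fun j => -g₀ j, by simp [hg₀], j₀, by simpa using h⟩
      · exact ⟨g₀, hg₀, j₀, h⟩
    -- The smallest ratio is the largest multiple of the relation that can be subtracted with all
    -- coefficients staying nonnegative; it annihilates the coefficient at `k`.
    obtain ⟨k, hk, hkmin⟩ := Finset.exists_min_image (Finset.univ.filter fun j => 0 < g j)
      (fun j => c j / g j) ⟨j₁, by simpa using hj₁⟩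
    rw [Finset.mem_filter] at hk
    set t := c k / g k with ht
    have ht0 : 0 ≤ t := div_nonneg (hc.1 _) hk.2.le
    let G : J → ℝ := fun j => if h : c j ≠ 0 then g ⟨j, h⟩ else 0
    have hGs : ∑ j, G j • v j = 0 := by
      rw [← hg]
      refine (Fintype.sum_of_injective Subtype.val Subtype.val_injective _ _ (fun j hj => ?_)
        fun j => ?_).symm
      · have : ¬ c j ≠ 0 := fun h => hj ⟨⟨j, h⟩, rfl⟩
        simp only [G, dif_neg this, zero_smul]
      · simp only [G, dif_pos j.2]
    have hmem : (fun j => c j - t * G j) ∈ A := by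
      refine ⟨fun j => ?_, ?_⟩
      · by_cases h : c j ≠ 0
        · simp only [G, dif_pos h]
          by_cases hp : 0 < g ⟨j, h⟩
          · have := hkmin ⟨j, h⟩ (by simpa using hp)
            rw [le_div_iff₀ hp] at this
            linarith
          · have := hc.1 j
            nlinarith [not_lt.1 hp]
        · simpa only [G, dif_neg h, mul_zero, sub_zero] using hc.1 j
      · simp only [sub_smul, mul_smul, Finset.sum_sub_distrib, ← Finset.smul_sum, hGs, smul_zero,
          sub_zero, hc.2]
    have hlt : (Finset.univ.filter fun j => c j - t * G j ≠ 0).card <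
        (Finset.univ.filter fun j => c j ≠ 0).card := by
      refine Finset.card_lt_card ⟨fun j hj => ?_, fun hsub => ?_⟩
      · simp only [Finset.mem_filter, Finset.mem_univ, true_and] at hj ⊢
        intro h
        exact hj (by simp [G, h])
      · have := hsub (Finset.mem_filter.2 ⟨Finset.mem_univ k.1, k.2⟩)
        simp only [Finset.mem_filter, Finset.mem_univ, true_and] at this
        apply this
        simp only [G, dif_pos k.2, ht]
        rw [div_mul_cancel₀ _ hk.2.ne', sub_self]
    exact absurd (hmin hmem hlt.le) (not_le.2 hlt)
  exact hli.fintype_card_le_finrank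

section Converse

variable {X Y Z : Type*} [Fintype X] [Fintype Y] [Fintype Z] {p : X × Y × Z → ℝ}

lemma law_zero {Ω A : Type*} [Fintype Ω] (f : Ω → A) (a : A) : law (0 : Ω → ℝ) f a = 0 := by
  simp [law]

lemma isSlice_zero : IsSlice p 0 where
  nonneg _ := le_rfl
  markov_source x z := by simp only [law_zero, zero_mul]
  markov_output x z y := by simp only [law_zero, zero_mul]

lemma entDiff_zero {A : Type*} [Fintype A] (f : X × Y × Z → A) : entDiff 0 f = 0 := by
  simp [entDiff, ent, law_zero]

/-- A family of slices can be padded with zeros. -/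
lemma exists_padded {J : Type*} [Fintype J] {M : ℕ} (hJ : Fintype.card J ≤ M)
    {u : J → X × Y × Z → ℝ} (hu : ∀ j, IsSlice p (u j)) :
    ∃ u' : Fin M → X × Y × Z → ℝ, (∀ k, IsSlice p (u' k)) ∧
      ∀ Φ : (X × Y × Z → ℝ) → ℝ, Φ 0 = 0 → ∑ k, Φ (u' k) = ∑ j, Φ (u j) := by
  obtain ⟨e⟩ := Function.Embedding.nonempty_of_card_le (α := J) (β := Fin M) (by simpa using hJ)
  refine ⟨Function.extend e u 0, fun k => ?_, fun Φ hΦ => ?_⟩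
  · by_cases hk : ∃ j, e j = k
    · obtain ⟨j, rfl⟩ := hk
      rw [e.injective.extend_apply]
      exact hu j
    · rw [Function.extend_apply' _ _ _ hk]
      exact isSlice_zero
  · refine (Fintype.sum_of_injective e e.injective _ _ (fun k hk => ?_) fun j => ?_).symm
    · rw [Function.extend_apply' _ _ _ hk]
      exact hΦ
    · rw [e.injective.extend_apply]

lemma law_of_subsingleton {Ω A : Type*} [Fintype Ω] [Subsingleton A] (q : Ω → ℝ) (f : Ω → A)
    (a : A) : law q f a = ∑ ω, q ω :=
  Finset.sum_congr rfl fun _ _ => if_pos (Subsingleton.elim _ _)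

lemma isSlice_of_subsingleton [Subsingleton X] [Subsingleton Y] [Subsingleton Z]
    {u : X × Y × Z → ℝ} (hu : ∀ s, 0 ≤ u s) : IsSlice p u where
  nonneg := hu
  markov_source x z := by simp only [law_of_subsingleton]
  markov_output x z y := by simp only [law_of_subsingleton]

lemma entDiff_of_subsingleton {A : Type*} [Fintype A] [Subsingleton A] [Subsingleton Z]
    [Nonempty A] [Nonempty Z] (u : X × Y × Z → ℝ) (f : X × Y × Z → A) : entDiff u f = 0 := by
  obtain ⟨a⟩ := ‹Nonempty A›
  obtain ⟨z⟩ := ‹Nonempty Z›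
  simp only [entDiff, ent, law_of_subsingleton]
  rw [Fintype.sum_subsingleton _ a, Fintype.sum_subsingleton _ z, sub_self]

/-- The bound on the size of the auxiliary alphabet. -/
lemma exists_slices_card [Nonempty X] [Nonempty Y] [Nonempty Z] {J : Type*} [Fintype J]
    {u : J → X × Y × Z → ℝ} (hu : ∀ j, IsSlice p (u j)) :
    ∃ u' : Fin ((Fintype.card X * Fintype.card Y * Fintype.card Z) ^ 2) → X × Y × Z → ℝ,
      (∀ k, IsSlice p (u' k)) ∧ (∀ s, ∑ k, u' k s = ∑ j, u j s) ∧
      ∑ k, entDiff (u' k) (fun s => s.1) = ∑ j, entDiff (u j) (fun s => s.1) ∧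
      ∑ k, entDiff (u' k) (fun s => s) = ∑ j, entDiff (u j) (fun s => s) := by
  have hX : 0 < Fintype.card X := Fintype.card_pos
  have hY : 0 < Fintype.card Y := Fintype.card_pos
  have hZ : 0 < Fintype.card Z := Fintype.card_pos
  set N := Fintype.card X * Fintype.card Y * Fintype.card Z with hN
  have hN0 : 0 < N := by positivity
  -- Carathéodory gives `N + 2` slices, which is at most `N ^ 2` only for `N ≥ 2`. For `N = 1` all
  -- conditions are void and all entropy differences zero, so the slices can simply be added up.
  rcases Nat.lt_or_ge N 2 with h1 | h2
  · have hN1 : N = 1 := by omega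
    have hXY : Fintype.card X * Fintype.card Y = 1 := Nat.eq_one_of_mul_eq_one_right (hN.symm.trans hN1)
    have : Subsingleton X := Fintype.card_le_one_iff_subsingleton.1
      (Nat.eq_one_of_mul_eq_one_right hXY).le
    have : Subsingleton Y := Fintype.card_le_one_iff_subsingleton.1
      (Nat.eq_one_of_mul_eq_one_left hXY).le
    have : Subsingleton Z := Fintype.card_le_one_iff_subsingleton.1
      (Nat.eq_one_of_mul_eq_one_left (hN.symm.trans hN1)).le
    obtain ⟨u', hu', hΦ⟩ := exists_padded (J := Unit) (M := N ^ 2) (p := p)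
      (u := fun _ s => ∑ j, u j s) (by rw [hN1]; simp)
      (fun _ => isSlice_of_subsingleton fun s => Finset.sum_nonneg fun j _ => (hu j).nonneg s)
    refine ⟨u', hu', fun s => by simpa using hΦ (fun u => u s) rfl, ?_, ?_⟩ <;>
    simp only [entDiff_of_subsingleton, Finset.sum_const_zero]
  -- The quantities to preserve are the `N` values of the sum of the slices and the two entropy
  -- sums.
  · obtain ⟨c, hc0, hc, hcard⟩ := exists_conic_combination (fun j =>
      ((u j, entDiff (u j) (fun s => s.1), entDiff (u j) (fun s => s)) :
        (X × Y × Z → ℝ) × ℝ × ℝ))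
    have hM : Fintype.card {j // c j ≠ 0} ≤ N ^ 2 := by
      refine hcard.trans ?_
      rw [Module.finrank_prod, Module.finrank_prod, Module.finrank_fintype_fun_eq_card,
        Module.finrank_self, Fintype.card_prod, Fintype.card_prod, ← mul_assoc, ← hN]
      nlinarith
    obtain ⟨u', hu', hΦ⟩ := exists_padded hM (p := p)
      (u := fun j : {j // c j ≠ 0} => fun s => c j * u j s) (fun j => (hu j).const_mul (hc0 j))
    have hsub : ∀ g : J → ℝ, ∑ j : {j // c j ≠ 0}, c j * g j = ∑ j, c j * g j := fun g =>
      Fintype.sum_of_injective Subtype.val Subtype.val_injective _ _ (fun j hj => by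
        have : c j = 0 := by
          by_contra h
          exact hj ⟨⟨j, h⟩, rfl⟩
        rw [this, zero_mul]) (fun _ => rfl)
    have e1 := congrArg Prod.fst hc
    have e2 := congrArg (fun a => a.2.1) hc
    have e3 := congrArg (fun a => a.2.2) hc
    simp only [Prod.fst_sum, Prod.snd_sum, Prod.smul_fst, Prod.smul_snd, smul_eq_mul] at e1 e2 e3
    refine ⟨u', hu', fun s => ?_, ?_, ?_⟩
    · rw [hΦ (fun u => u s) rfl, hsub (fun j => u j s)]
      simpa using congrFun e1 s
    · rw [hΦ (fun u => entDiff u _) (entDiff_zero _)]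
      simp only [entDiff_const_mul]
      rw [hsub (fun j => entDiff (u j) _), e2]
    · rw [hΦ (fun u => entDiff u _) (entDiff_zero _)]
      simp only [entDiff_const_mul]
      rw [hsub (fun j => entDiff (u j) _), e3]

/-- The converse up to an error `ε`, with an auxiliary alphabet of bounded size. -/
lemma exists_slices_of_achievable [Nonempty X] [Nonempty Y] [Nonempty Z]
    (hp : p ∈ stdSimplex ℝ (X × Y × Z)) {R C : ℝ} (hC : 0 ≤ C) (h : (R, C) ∈ achievableRegion p)
    {ε : ℝ} (hε : 0 < ε) :
    ∃ u : Fin ((Fintype.card X * Fintype.card Y * Fintype.card Z) ^ 2) → X × Y × Z → ℝ,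
      (∀ k, IsSlice p (u k)) ∧ ∑ s, |∑ k, u k s - p s| ≤ 2 * ε ∧
      ent p (fun s => s.1) - ent p (fun s => s.2.2) - ∑ k, entDiff (u k) (fun s => s.1) ≤
        (R + ε) * Real.log 2 ∧
      ent p (fun s => s) - ent p (fun s => s.2.2) - ∑ k, entDiff (u k) (fun s => s) ≤
        (R + C) * Real.log 2 +
          ε * (2 + Real.log 2 + Real.log (Fintype.card X * (Fintype.card Y * Fintype.card Z))) := by
  have hl2 : 0 < Real.log 2 := Real.log_pos one_lt_two
  obtain ⟨N, hN⟩ := h ε hε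
  -- Taking `n ≥ 1 / ε` as well lets the additive constant 1 in the continuity bound be absorbed
  -- into `n * ε`.
  obtain ⟨m, hm⟩ := exists_nat_ge (1 / ε)
  set n := max N (max m 1) with hn
  have hn0 : 0 < n := lt_of_lt_of_le one_pos ((le_max_right m 1).trans (le_max_right N _))
  have hn' : (0 : ℝ) < n := by exact_mod_cast hn0
  have hn1 : (1 : ℝ) ≤ n := by exact_mod_cast hn0
  have hnε : 1 ≤ n * ε := by
    have : (m : ℝ) ≤ n := by exact_mod_cast (le_max_left m 1).trans (le_max_right N _)
    rw [← div_le_iff₀ hε]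
    linarith
  obtain ⟨Θ, c, htv, hrate⟩ := hN n (le_max_left _ _)
  dsimp only at c htv hrate
  have hK1 : 1 ≤ ⌊(2 : ℝ) ^ ((n : ℝ) * C)⌋₊ :=
    Nat.le_floor (by simpa using Real.one_le_rpow one_le_two (by positivity))
  have hKlog : Real.log ⌊(2 : ℝ) ^ ((n : ℝ) * C)⌋₊ ≤ n * C * Real.log 2 := by
    rw [← Real.log_rpow two_pos]
    exact Real.log_le_log (by exact_mod_cast hK1) (Nat.floor_le (by positivity))
  have hΘlog : Real.log Θ ≤ n * ((R + ε) * Real.log 2) := by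
    rw [one_div, inv_mul_le_iff₀ hn', Real.logb, div_le_iff₀ hl2] at hrate
    linarith
  obtain ⟨v, hv, hvtv, hv1, hv2⟩ := c.exists_slices hp hK1 hn0
  obtain ⟨u, hu, hus, hu1, hu2⟩ := exists_slices_card hv
  have hfan := entropy_le_of_tvDist (c.inducedPMF_mem hp hK1) (iidPMF_mem hp n) htv
  have hcard : Real.log (Fintype.card ((Fin n → X) × (Fin n → Y) × (Fin n → Z))) =
      n * Real.log (Fintype.card X * (Fintype.card Y * Fintype.card Z)) := by
    simp only [Fintype.card_prod, Fintype.card_fun, Fintype.card_fin, Nat.cast_mul, Nat.cast_pow,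
      ← mul_pow, Real.log_pow]
  rw [hcard, sum_negMulLog_iidPMF hp] at hfan
  refine ⟨u, hu, ?_, ?_, ?_⟩
  · simp only [hus]
    linarith
  · rw [hu1]
    exact le_of_mul_le_mul_left (hv1.trans hΘlog) hn'
  · rw [hu2]
    refine le_of_mul_le_mul_left ?_ hn'
    -- The 2 in the error term comes from `1 ≤ n * ε` and `ε ≤ n * ε`; the summand `ε * log 2` comes
    -- from the message rate.
    nlinarith [mul_le_mul_of_nonneg_right hn1 hε.le]

lemma continuous_law {Ω A : Type*} [Fintype Ω] (f : Ω → A) (a : A) :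
    Continuous fun q : Ω → ℝ => law q f a := by
  classical
  refine continuous_finsetSum _ fun ω _ => ?_
  by_cases h : f ω = a
  · simpa only [if_pos h] using continuous_apply ω
  · simpa only [if_neg h] using continuous_const

lemma continuous_ent {Ω A : Type*} [Fintype Ω] [Fintype A] (f : Ω → A) :
    Continuous fun q : Ω → ℝ => ent q f := by
  refine continuous_finsetSum _ fun a _ => Real.continuous_negMulLog.comp ?_
  exact continuous_law f a

end Converse

/-! ### Compactness, and reassembling the slices into a joint PMF. -/

section Limit

variable {X Y Z : Type*} [Fintype X] [Fintype Y] [Fintype Z] {p : X × Y × Z → ℝ}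

lemma continuous_entDiff {A : Type*} [Fintype A] (f : X × Y × Z → A) :
    Continuous fun u : X × Y × Z → ℝ => entDiff u f :=
  (continuous_ent f).sub (continuous_ent _)

lemma tendsto_sum_entDiff {A : Type*} [Fintype A] (f : X × Y × Z → A) {M : ℕ}
    {u : ℕ → Fin M → X × Y × Z → ℝ} {v : Fin M → X × Y × Z → ℝ}
    (h : ∀ k, Tendsto (fun m => u m k) atTop (𝓝 (v k))) :
    Tendsto (fun m => ∑ k, entDiff (u m k) f) atTop (𝓝 (∑ k, entDiff (v k) f)) :=
  tendsto_finsetSum _ fun k _ => ((continuous_entDiff f).tendsto _).comp (h k)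

/-- In product form the Markov conditions are polynomial equations, so they survive limits even
where conditional probabilities cease to be defined. -/
lemma isClosed_isSlice (p : X × Y × Z → ℝ) : IsClosed {u | IsSlice p u} := by
  have : {u | IsSlice p u} = {u | ∀ s, 0 ≤ u s} ∩
      ({u | ∀ x z, law u (fun s => (s.1, s.2.2)) (x, z) * law p (fun s => s.1) x =
        law u (fun s => s.1) x * law p (fun s => (s.1, s.2.2)) (x, z)} ∩
      {u | IsMarkovChain u (fun s => s.1) (fun s => s.2.2) (fun s => s.2.1)}) := by
    ext u
    exact ⟨fun h => ⟨h.1, h.2, h.3⟩, fun h => ⟨h.1, h.2.1, h.2.2⟩⟩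
  rw [this]
  simp only [IsMarkovChain, Set.ofPred_forall]
  refine (isClosed_iInter fun s => isClosed_le continuous_const (continuous_apply s)).inter
    ((isClosed_iInter fun x => isClosed_iInter fun z => isClosed_eq
      ((continuous_law _ _).mul continuous_const) ((continuous_law _ _).mul continuous_const)).inter
    (isClosed_iInter fun x => isClosed_iInter fun z => isClosed_iInter fun y => isClosed_eq
      ((continuous_law _ _).mul (continuous_law _ _))
      ((continuous_law _ _).mul (continuous_law _ _))))

/-- The converse, in terms of slices. -/
lemma exists_limit_slices [Nonempty X] [Nonempty Y] [Nonempty Z]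
    (hp : p ∈ stdSimplex ℝ (X × Y × Z)) {R C : ℝ} (hC : 0 ≤ C)
    (h : (R, C) ∈ achievableRegion p) :
    ∃ u : Fin ((Fintype.card X * Fintype.card Y * Fintype.card Z) ^ 2) → X × Y × Z → ℝ,
      (∀ k, IsSlice p (u k)) ∧ (∀ s, ∑ k, u k s = p s) ∧
      ent p (fun s => s.1) - ent p (fun s => s.2.2) - ∑ k, entDiff (u k) (fun s => s.1) ≤
        R * Real.log 2 ∧
      ent p (fun s => s) - ent p (fun s => s.2.2) - ∑ k, entDiff (u k) (fun s => s) ≤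
        (R + C) * Real.log 2 := by
  set ε : ℕ → ℝ := fun m => 1 / ((m : ℝ) + 1) with hε
  have hε0 : ∀ m, 0 < ε m := fun m => Nat.one_div_pos_of_nat
  have hε1 : ∀ m, ε m ≤ 1 := fun m => by
    rw [hε]
    exact (div_le_one (by positivity)).2 (by linarith [(Nat.cast_nonneg m : (0 : ℝ) ≤ m)])
  choose u hu htv h1 h2 using fun m => exists_slices_of_achievable hp hC h (hε0 m)
  -- The number of slices does not depend on the error, so all families lie in one compact box; the
  -- bound 3 is `1 + 2 * ε m` with `ε m ≤ 1`.
  have hbound : ∀ m, u m ∈ Set.Icc (0 : Fin ((Fintype.card X * Fintype.card Y *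
      Fintype.card Z) ^ 2) → X × Y × Z → ℝ) (fun _ _ => 3) := by
    refine fun m => ⟨fun k s => (hu m k).nonneg s, fun k s => ?_⟩
    have i1 : u m k s ≤ ∑ k, u m k s :=
      Finset.single_le_sum (f := fun k => u m k s) (fun k _ => (hu m k).nonneg s)
        (Finset.mem_univ k)
    have i2 : |∑ k, u m k s - p s| ≤ 2 * ε m :=
      (Finset.single_le_sum (f := fun s => |∑ k, u m k s - p s|) (fun s _ => abs_nonneg _)
        (Finset.mem_univ s)).trans (htv m)
    have i3 : p s ≤ 1 := hp.2 ▸ Finset.single_le_sum (fun s _ => hp.1 s) (Finset.mem_univ s)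
    have := le_abs_self (∑ k, u m k s - p s)
    linarith [hε1 m]
  obtain ⟨v, -, φ, hφ, hv⟩ := isCompact_Icc.tendsto_subseq hbound
  have hεlim : Tendsto (fun m => ε (φ m)) atTop (𝓝 0) :=
    tendsto_one_div_add_atTop_nhds_zero_nat.comp hφ.tendsto_atTop
  have hvk : ∀ k, Tendsto (fun m => u (φ m) k) atTop (𝓝 (v k)) := fun k =>
    (tendsto_pi_nhds.1 hv) k
  have hX := tendsto_sum_entDiff (fun s => s.1) hvk
  have hS := tendsto_sum_entDiff (fun s => s) hvk
  refine ⟨v, fun k => (isClosed_isSlice p).mem_of_tendsto (hvk k)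
    (Eventually.of_forall fun m => hu (φ m) k), ?_, ?_, ?_⟩
  · intro s
    have l1 : Tendsto (fun m => |∑ k, u (φ m) k s - p s|) atTop (𝓝 |∑ k, v k s - p s|) :=
      ((tendsto_finsetSum _ fun k _ => (tendsto_pi_nhds.1 (hvk k)) s).sub_const _).abs
    have l2 : Tendsto (fun m => 2 * ε (φ m)) atTop (𝓝 0) := by simpa using hεlim.const_mul 2
    have := le_of_tendsto_of_tendsto' l1 l2 fun m =>
      (Finset.single_le_sum (f := fun s => |∑ k, u (φ m) k s - p s|) (fun s _ => abs_nonneg _)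
        (Finset.mem_univ s)).trans (htv (φ m))
    exact sub_eq_zero.1 (abs_nonpos_iff.1 this)
  · refine le_of_tendsto_of_tendsto' (hX.const_sub _) ?_ fun m => h1 (φ m)
    simpa using (hεlim.const_add R).mul_const (Real.log 2)
  · refine le_of_tendsto_of_tendsto' (hS.const_sub _) ?_ fun m => h2 (φ m)
    simpa using (hεlim.mul_const _).const_add ((R + C) * Real.log 2)

variable {k : ℕ} {u : Fin k → X × Y × Z → ℝ} {q : Fin k × X × Y × Z → ℝ}

lemma law_glue (hq : q = fun ω => u ω.1 ω.2) {A : Type*} (f : X × Y × Z → A) (w : Fin k) (a : A) :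
    law q (fun ω => (ω.1, f ω.2)) (w, a) = law (u w) f a := by
  classical
  simp only [hq, law, Fintype.sum_prod_type (α₁ := Fin k), Prod.mk.injEq]
  rw [Finset.sum_eq_single w (by simp +contextual) (by simp)]
  simp

lemma law_glue_marginal (hq : q = fun ω => u ω.1 ω.2) (hup : ∀ s, ∑ w, u w s = p s) {A : Type*}
    (f : X × Y × Z → A) (a : A) : law q (fun ω => f ω.2) a = law p f a := by
  have h := sum_law_prod_left q (fun ω => ω.1) (fun ω => f ω.2) a
  rw [← h]
  simp only [law_glue hq f]
  rw [← law_finset_sum]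
  congr 1
  exact funext hup

lemma ent_glue (hq : q = fun ω => u ω.1 ω.2) {A : Type*} [Fintype A] (f : X × Y × Z → A) :
    ent q (fun ω => (ω.1, f ω.2)) = ∑ w, ent (u w) f := by
  simp only [ent, Fintype.sum_prod_type, law_glue hq f]

lemma ent_glue_marginal (hq : q = fun ω => u ω.1 ω.2) (hup : ∀ s, ∑ w, u w s = p s) {A : Type*}
    [Fintype A] (f : X × Y × Z → A) : ent q (fun ω => f ω.2) = ent p f :=
  ent_congr_law (law_glue_marginal hq hup f)

/-- A family of slices gives a PMF with the two Markov chains and with mutual informations given by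
the entropy differences of the slices. -/
lemma glue_spec (hp : p ∈ stdSimplex ℝ (X × Y × Z)) (hu : ∀ w, IsSlice p (u w))
    (hup : ∀ s, ∑ w, u w s = p s) (hq : q = fun ω => u ω.1 ω.2) :
    q ∈ stdSimplex ℝ (Fin k × X × Y × Z) ∧
    IsMarkovChain q (fun ω => ω.2.2.2) (fun ω => ω.2.1) (fun ω => ω.1) ∧
    IsMarkovChain q (fun ω => ω.2.1) (fun ω => (ω.2.2.2, ω.1)) (fun ω => ω.2.2.1) ∧
    mutualInfo q (fun ω => ω.2.1) (fun ω => ω.1) - mutualInfo q (fun ω => ω.1) (fun ω => ω.2.2.2) =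
      (ent p (fun s => s.1) - ent p (fun s => s.2.2) -
        ∑ w, entDiff (u w) (fun s => s.1)) / Real.log 2 ∧
    mutualInfo q (fun ω => ω.2) (fun ω => ω.1) - mutualInfo q (fun ω => ω.1) (fun ω => ω.2.2.2) =
      (ent p (fun s => s) - ent p (fun s => s.2.2) -
        ∑ w, entDiff (u w) (fun s => s)) / Real.log 2 := by
  have hq0 : ∀ ω, 0 ≤ q ω := fun ω => by rw [hq]; exact (hu ω.1).nonneg ω.2
  refine ⟨⟨hq0, ?_⟩, fun z x w => ?_, fun x zw y => ?_, ?_, ?_⟩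
  · simp only [hq]
    rw [Fintype.sum_prod_type_right]
    simp only [hup]
    exact hp.2
  · have e1 : law q (fun ω => (ω.2.2.2, ω.2.1, ω.1)) (z, x, w) =
        law (u w) (fun s => (s.1, s.2.2)) (x, z) := by
      rw [← law_glue hq (fun s => (s.1, s.2.2))]
      exact law_comp_injective q (fun ω => (ω.1, (ω.2.1, ω.2.2.2)))
        (g := fun a => (a.2.2, a.2.1, a.1)) (fun a b hab => by
          simp only [Prod.mk.injEq] at hab
          exact Prod.ext hab.2.2 (Prod.ext hab.2.1 hab.1)) (w, (x, z))
    have e2 := law_swap q (fun ω => ω.2.2.2) (fun ω => ω.2.1) z x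
    have e3 := law_swap q (fun ω => ω.2.1) (fun ω => ω.1) x w
    rw [e1, e2, e3, law_glue_marginal hq hup (fun s => s.1), law_glue_marginal hq hup (fun s => (s.1, s.2.2)), law_glue hq (fun s => s.1),
      (hu w).markov_source]
    ring
  · obtain ⟨z, w⟩ := zw
    have e1 : law q (fun ω => (ω.2.1, (ω.2.2.2, ω.1), ω.2.2.1)) (x, (z, w), y) =
        law (u w) (fun s => (s.1, s.2.2, s.2.1)) (x, z, y) := by
      rw [← law_glue hq (fun s => (s.1, s.2.2, s.2.1))]
      exact law_comp_injective q (fun ω => (ω.1, (ω.2.1, ω.2.2.2, ω.2.2.1)))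
        (g := fun a => (a.2.1, (a.2.2.1, a.1), a.2.2.2)) (fun a b hab => by
          simp only [Prod.mk.injEq] at hab
          exact Prod.ext hab.2.1.2 (Prod.ext hab.1 (Prod.ext hab.2.1.1 hab.2.2))) (w, (x, z, y))
    have e2 : law q (fun ω => (ω.2.1, (ω.2.2.2, ω.1))) (x, (z, w)) =
        law (u w) (fun s => (s.1, s.2.2)) (x, z) := by
      rw [← law_glue hq (fun s => (s.1, s.2.2))]
      exact law_comp_injective q (fun ω => (ω.1, (ω.2.1, ω.2.2.2)))
        (g := fun a => (a.2.1, (a.2.2, a.1))) (fun a b hab => by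
          simp only [Prod.mk.injEq] at hab
          exact Prod.ext hab.2.2 (Prod.ext hab.1 hab.2.1)) (w, (x, z))
    have e3 : law q (fun ω => ((ω.2.2.2, ω.1), ω.2.2.1)) ((z, w), y) =
        law (u w) (fun s => (s.2.2, s.2.1)) (z, y) := by
      rw [← law_glue hq (fun s => (s.2.2, s.2.1))]
      exact law_comp_injective q (fun ω => (ω.1, (ω.2.2.2, ω.2.2.1)))
        (g := fun a => ((a.2.1, a.1), a.2.2)) (fun a b hab => by
          simp only [Prod.mk.injEq] at hab
          exact Prod.ext hab.1.2 (Prod.ext hab.1.1 hab.2)) (w, (z, y))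
    have e4 := law_swap q (fun ω => ω.2.2.2) (fun ω => ω.1) z w
    rw [e1, e2, e3, e4, law_glue hq (fun s => s.2.2)]
    exact (hu w).markov_output x z y
  -- The entropy of `W` cancels in the difference of the mutual informations, leaving joint
  -- entropies with `W`, which are sums over slices, and marginal entropies of `p`.
  · rw [mutualInfo_eq hq0, mutualInfo_eq hq0, ent_swap q (fun ω => ω.2.1), ent_glue hq (fun s => s.1),
      ent_glue hq (fun s => s.2.2), ent_glue_marginal hq hup (fun s => s.1), ent_glue_marginal hq hup (fun s => s.2.2)]
    simp only [entDiff, Finset.sum_sub_distrib]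
    ring
  · rw [mutualInfo_eq hq0, mutualInfo_eq hq0, ent_swap q (fun ω => ω.2), ent_glue hq (fun s => s),
      ent_glue hq (fun s => s.2.2), ent_glue_marginal hq hup (fun s => s), ent_glue_marginal hq hup (fun s => s.2.2)]
    simp only [entDiff, Finset.sum_sub_distrib]
    ring

end Limit

end ChannelSynthesis

open ChannelSynthesis in
theorem theorem1 {X Y Z : Type*} [Fintype X] [Fintype Y] [Fintype Z]
    (p : X × Y × Z → ℝ) (hp : p ∈ stdSimplex ℝ (X × Y × Z)) (R C : ℝ) (hC : 0 ≤ C) :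
    (R, C) ∈ achievableRegion p ↔
      ∃ (k : ℕ) (q : Fin k × X × Y × Z → ℝ),
        k ≤ (Fintype.card X * Fintype.card Y * Fintype.card Z) ^ 2 ∧
        q ∈ stdSimplex ℝ (Fin k × X × Y × Z) ∧
        (∀ x y z, p (x, y, z) = ∑ w, q (w, x, y, z)) ∧
        IsMarkovChain q (fun ω => ω.2.2.2) (fun ω => ω.2.1) (fun ω => ω.1) ∧
        IsMarkovChain q (fun ω => ω.2.1) (fun ω => (ω.2.2.2, ω.1)) (fun ω => ω.2.2.1) ∧
        mutualInfo q (fun ω => ω.2.1) (fun ω => ω.1)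
            - mutualInfo q (fun ω => ω.1) (fun ω => ω.2.2.2) ≤ R ∧
        mutualInfo q (fun ω => ω.2) (fun ω => ω.1)
            - mutualInfo q (fun ω => ω.1) (fun ω => ω.2.2.2) ≤ R + C := by
  constructor
  · intro h
    have hne : Nonempty (X × Y × Z) := by
      by_contra hcon
      rw [not_nonempty_iff] at hcon
      simpa using hp.2
    obtain ⟨x, y, z⟩ := hne
    have : Nonempty X := ⟨x⟩
    have : Nonempty Y := ⟨y⟩
    have : Nonempty Z := ⟨z⟩
    obtain ⟨u, hu, hup, h1, h2⟩ := exists_limit_slices hp hC h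
    obtain ⟨hq, hM₁, hM₂, e1, e2⟩ := glue_spec hp hu hup rfl
    have hl2 : 0 < Real.log 2 := Real.log_pos one_lt_two
    refine ⟨_, fun ω => u ω.1 ω.2, le_rfl, hq, fun x y z => (hup _).symm, hM₁, hM₂, ?_, ?_⟩
    · rw [e1, div_le_iff₀ hl2]
      exact h1
    · rw [e2, div_le_iff₀ hl2]
      exact h2
  · rintro ⟨k, q, -, hq, hpq, hM₁, hM₂, h1, h2⟩
    exact achievable_of_markov hp hC hq hpq hM₁ hM₂ h1 h2
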